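/- **Setting.** Let $A\in\mathbb{Q}^{n\times n}$ be expanding (all complex eigenvalues have modulus $>1$), $B=A^{-1}$, and let $\mathbb{Z}^n[A]=\sum_{k\ge 0}A^k\mathbb{Z}^n$, $\mathbb{Z}^n[B]=\sum_{k\ge 0}B^k\mathbb{Z}^n$, $\mathbb{Z}^n(B)=\sum_{k\in\mathbb{Z}}B^k\mathbb{Z}^n$. Put $a=|\mathbb{Z}^n[A]/A\mathbb{Z}^n[A]|$ and $b=|\mathbb{Z}^n[B]/B\mathbb{Z}^n[B]|$, and assume $b\ge 2$. For $y\in\mathbb{Z}^n(B)$ let $\nu(y)$ be the integer $k$ with $y\in B^k\mathbb{Z}^n[B]\setminus B^{k+1}\mathbb{Z}^n[B]$, and $\nu(y)=\infty$ if there is none. Let $\mathbb{Z}^n((B))$ be the (Hausdorff) completion of $\mathbb{Z}^n(B)$ for the pseudometric $\mathbf{d}_B(y,y')=b^{-\nu(y-y')}$ (with $b^{-\infty}=0$), and let $\mathbb{Z}^n[[B]]$ be its closed unit ball. The representation space is $\mathbb{K}_A=\mathbb{R}^n\times\mathbb{Z}^n((B))$, with the maximum of the Euclidean and the $B$-adic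 metric, with the Haar measure $\mu=\lambda\times\mu_B$, where $\lambda$ is Lebesgue measure and $\mu_B$ is the Haar measure with $\mu_B(\mathbb{Z}^n[[B]])=1$, and with the action $A(x,y)=(Ax,Ay)$. Let $\varphi:\mathbb{Z}^n(B)\to\mathbb{K}_A$, $\varphi(x)=(x,x)$. Let $\mathcal{D}\subset\mathbb{Z}^n[A]$ be a digit set, that is, $|\mathcal{D}|=a$, and let $\mathcal{F}\subset\mathbb{K}_A$ be the unique nonempty compact set with $A\mathcal{F}=\bigcup_{d\in\mathcal{D}}(\mathcal{F}+\varphi(d))$. For $k\ge 1$ let $\mathcal{D}_k=\{d_0+Ad_1+\dots+A^{k-1}d_{k-1}\mid d_0,\dots,d_{k-1}\in\mathcal{D}\}$, and let $\Delta=\bigcup_{k\ge 1}\varphi(\mathcal{D}_k-\mathcal{D}_k)$. For $\mathcal{S}\subset\mathbb{K}_A$, the collection $\mathcal{F}+\mathcal{S}=\{\mathcal{F}+s\mid s\in\mathcal{S}\}$ is a *tiling* of $\mathbb{K}_A$ if it covers $\mathbb{K}_A$ and $\mu((\mathcal{F}+s)\cap(\mathcal{F}+s'))=0$ for all $s\ne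 s'$ in $\mathcal{S}$. A tiling $\mathcal{F}+\mathcal{S}$ is *self-replicating*, with associated map $T$, if $T$ is an expanding linear map of $\mathbb{K}_A$ and for each $s\in\mathcal{S}$ there is a finite $J(s)\subset\mathcal{S}$ with $T(\mathcal{F}+s)=\bigcup_{s'\in J(s)}(\mathcal{F}+s')$. Here an expanding linear map is a continuous additive bijection $T$ that commutes with the action of $A$ and for which there are $c>0$, $r>1$ with $\mathbf{d}(T^mp,T^mq)\ge c\,r^m\,\mathbf{d}(p,q)$ for all $m\ge 0$ and $p,q\in\mathbb{K}_A$. The tiling is *atomic* if the origin lies in exactly one of the tiles $\mathcal{F}+s$, $s\in\mathcal{S}$. **Theorem.** Suppose that $\mathcal{F}$ contains a nonempty open set. Then: (i) There is a set $\mathcal{S}\subset\Delta$ such that $\mathcal{F}+\mathcal{S}$ is a tiling of $\mathbb{K}_A$. Furthermore, there are a translate $\mathcal{S}'=\mathcal{S}+t$ ($t\in\mathbb{K}_A$) of $\mathcal{S}$ and a $k\ge 1$ such that $\mathcal{F}+\mathcal{S}'$ is an atomic self-replicating tiling of $\mathbb{K}_A$ with associated expanding linear map $T=A^k$. (ii)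 If $\Delta$ is a group, then $\mathcal{F}+\Delta$ is a tiling of $\mathbb{K}_A$. -/

import Mathlib

open Set Filter Topology MeasureTheory
open scoped Pointwise

noncomputable section

namespace RationalTile

variable {n : ℕ}

/-- A rational matrix is expanding if all its complex eigenvalues lie outside the closed
unit disc. -/
def IsExpanding (A : Matrix (Fin n) (Fin n) ℚ) : Prop :=
  ∀ z ∈ spectrum ℂ (A.map (algebraMap ℚ ℂ)), 1 < ‖z‖

/-- Multiplication by a rational matrix, as an endomorphism of the additive group `ℚⁿ`. -/
def mulHom (M : Matrix (Fin n) (Fin n) ℚ) : (Fin n → ℚ) →+ (Fin n → ℚ) :=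
  M.mulVecLin.toAddMonoidHom

/-- The subgroup `ℤⁿ` of `ℚⁿ`. -/
def intLattice (n : ℕ) : AddSubgroup (Fin n → ℚ) :=
  AddSubgroup.pi Set.univ fun _ => (Int.castAddHom ℚ).range

/-- `ℤⁿ[A] = ℤⁿ + A ℤⁿ + A² ℤⁿ + ⋯`. -/
def polyLattice (A : Matrix (Fin n) (Fin n) ℚ) : AddSubgroup (Fin n → ℚ) :=
  ⨆ k : ℕ, (intLattice n).map (mulHom (A ^ k))

/-- `ℤⁿ(A) = ∑_{k ∈ ℤ} A ^ k ℤⁿ`. -/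
def laurentLattice (A : Matrix (Fin n) (Fin n) ℚ) : AddSubgroup (Fin n → ℚ) :=
  ⨆ k : ℤ, (intLattice n).map (mulHom (A ^ k))

/-- `a = |ℤⁿ[A] / A ℤⁿ[A]|`. -/
def aIndex (A : Matrix (Fin n) (Fin n) ℚ) : ℕ :=
  ((polyLattice A).map (mulHom A)).relIndex (polyLattice A)

/-- `b = |ℤⁿ[A⁻¹] / A⁻¹ ℤⁿ[A⁻¹]|`. -/
def bIndex (A : Matrix (Fin n) (Fin n) ℚ) : ℕ := aIndex A⁻¹

/-- The subgroup `B ^ k ℤⁿ[B]`, `k ∈ ℤ`, where `B = A⁻¹`. -/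
def bFil (A : Matrix (Fin n) (Fin n) ℚ) (k : ℤ) : AddSubgroup (Fin n → ℚ) :=
  (polyLattice A⁻¹).map (mulHom (A⁻¹ ^ k))

/-- The group `ℤⁿ(B) = ℤⁿ(A)` as a type of its own, which is to carry the `B`-adic metric. -/
def ZLaurent (A : Matrix (Fin n) (Fin n) ℚ) : Type := laurentLattice A

instance (A : Matrix (Fin n) (Fin n) ℚ) : AddCommGroup (ZLaurent A) :=
  inferInstanceAs (AddCommGroup (laurentLattice A))

/-- The inclusion `ℤⁿ(B) → ℚⁿ`. -/
def ZLaurent.val {A : Matrix (Fin n) (Fin n) ℚ} : ZLaurent A →+ (Fin n → ℚ) :=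
  (laurentLattice A).subtype

open Classical in
/-- The `B`-adic valuation: the `k` with `y ∈ B ^ k ℤⁿ[B] \ B ^ (k + 1) ℤⁿ[B]`, and `∞` if there
is none (as for `y = 0`). -/
def bVal {A : Matrix (Fin n) (Fin n) ℚ} (y : ZLaurent A) : WithTop ℤ :=
  if h : ∃ k : ℤ, y.val ∈ bFil A k ∧ y.val ∉ bFil A (k + 1) then (h.choose : ℤ) else ⊤

/-- `b ^ (-ν(y))`, the `B`-adic distance of `y` from `0`, with `b ^ (-∞) = 0`. -/
def bNorm {A : Matrix (Fin n) (Fin n) ℚ} (y : ZLaurent A) : ℝ :=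
  WithTop.recTopCoe (C := fun _ => ℝ) 0 (fun k : ℤ => (bIndex A : ℝ) ^ (-k)) (bVal y)

/-! ### Elementary facts on the filtration -/

section Basics

theorem mulHom_apply (M : Matrix (Fin n) (Fin n) ℚ) (x : Fin n → ℚ) :
    mulHom M x = M.mulVec x := rfl

theorem mulHom_mul (M N : Matrix (Fin n) (Fin n) ℚ) :
    mulHom (M * N) = (mulHom M).comp (mulHom N) := by
  refine AddMonoidHom.ext fun x => ?_
  simp [mulHom_apply, Matrix.mulVec_mulVec]

theorem mulHom_one : mulHom (1 : Matrix (Fin n) (Fin n) ℚ) = AddMonoidHom.id _ := by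
  refine AddMonoidHom.ext fun x => ?_
  simp [mulHom_apply]

theorem mem_intLattice {x : Fin n → ℚ} : x ∈ intLattice n ↔ ∀ i, ∃ m : ℤ, (m : ℚ) = x i := by
  simp [intLattice, AddSubgroup.mem_pi, AddSubgroup.mem_zmultiples_iff]

theorem IsExpanding.isUnit_det {A : Matrix (Fin n) (Fin n) ℚ} (h : IsExpanding A) :
    IsUnit A.det := by
  by_contra hA
  have h0 : (0 : ℂ) ∈ spectrum ℂ (A.map (algebraMap ℚ ℂ)) := by
    rw [spectrum.zero_mem_iff, Matrix.isUnit_iff_isUnit_det]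
    have : (A.map (algebraMap ℚ ℂ)).det = algebraMap ℚ ℂ A.det :=
      (RingHom.map_det (algebraMap ℚ ℂ) A).symm
    rw [this]
    simpa using hA
  have := h 0 h0
  simp at this
  linarith

theorem intLattice_le_polyLattice (A : Matrix (Fin n) (Fin n) ℚ) :
    intLattice n ≤ polyLattice A := by
  refine le_trans ?_ (le_iSup _ 0)
  simp [mulHom_one]

theorem map_polyLattice_le (A : Matrix (Fin n) (Fin n) ℚ) :
    (polyLattice A).map (mulHom A) ≤ polyLattice A := by
  rw [polyLattice, AddSubgroup.map_iSup]
  refine iSup_le fun k => le_trans (le_of_eq ?_) (le_iSup _ (k + 1))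
  rw [AddSubgroup.map_map, ← mulHom_mul, pow_succ']

theorem bFil_succ {A : Matrix (Fin n) (Fin n) ℚ} (hA : IsUnit A.det) (k : ℤ) :
    bFil A (k + 1) = ((polyLattice A⁻¹).map (mulHom A⁻¹)).map (mulHom (A⁻¹ ^ k)) := by
  rw [bFil, Matrix.zpow_add_one (Matrix.isUnit_nonsing_inv_det A hA), mulHom_mul,
    AddSubgroup.map_map]

theorem bFil_antitone {A : Matrix (Fin n) (Fin n) ℚ} (hA : IsUnit A.det) :
    Antitone (bFil A) :=
  antitone_int_of_succ_le fun k => by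
    rw [bFil_succ hA]
    exact AddSubgroup.map_mono (map_polyLattice_le _)

theorem bFil_zero (A : Matrix (Fin n) (Fin n) ℚ) : bFil A 0 = polyLattice A⁻¹ := by
  simp [bFil, mulHom_one]

theorem polyLattice_inv_le (A : Matrix (Fin n) (Fin n) ℚ) (hA : IsUnit A.det) :
    polyLattice A⁻¹ ≤ laurentLattice A :=
  iSup_le fun k => le_trans (le_of_eq (by
    rw [Matrix.zpow_neg hA, zpow_natCast, Matrix.inv_pow'])) (le_iSup _ (-(k : ℤ)))

theorem polyLattice_le (A : Matrix (Fin n) (Fin n) ℚ) :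
    polyLattice A ≤ laurentLattice A :=
  iSup_le fun k => le_trans (le_of_eq (by rw [zpow_natCast])) (le_iSup _ (k : ℤ))

theorem mem_bFil_zpow {A : Matrix (Fin n) (Fin n) ℚ} (hA : IsUnit A.det) (j k : ℤ)
    {y : Fin n → ℚ} (hy : y ∈ bFil A j) : mulHom (A ^ k) y ∈ bFil A (j - k) := by
  obtain ⟨p, hp, rfl⟩ := hy
  refine ⟨p, hp, ?_⟩
  have : A⁻¹ ^ (j - k) = A ^ k * A⁻¹ ^ j := by
    rw [Matrix.inv_zpow' hA, Matrix.inv_zpow' hA, ← Matrix.zpow_add hA]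
    congr 1
    ring
  rw [this, mulHom_mul]
  rfl

theorem zpow_mem_laurentLattice {A : Matrix (Fin n) (Fin n) ℚ} (hA : IsUnit A.det) (k : ℤ)
    {y : Fin n → ℚ} (hy : y ∈ laurentLattice A) : mulHom (A ^ k) y ∈ laurentLattice A := by
  have h : (laurentLattice A).map (mulHom (A ^ k)) ≤ laurentLattice A := by
    rw [laurentLattice, AddSubgroup.map_iSup]
    refine iSup_le fun j => le_trans (le_of_eq ?_) (le_iSup _ (k + j))
    rw [AddSubgroup.map_map, ← mulHom_mul, Matrix.zpow_add hA]
  exact h ⟨y, hy, rfl⟩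

theorem exists_mem_bFil {A : Matrix (Fin n) (Fin n) ℚ} (hA : IsUnit A.det) (y : ZLaurent A) :
    ∃ k, y.val ∈ bFil A k := by
  obtain ⟨y, hy⟩ := y
  change ∃ k, y ∈ bFil A k
  refine AddSubgroup.iSup_induction (C := fun y => ∃ k, y ∈ bFil A k) _ hy ?_ ?_ ?_
  · rintro k _ ⟨z, hz, rfl⟩
    refine ⟨-k, z, intLattice_le_polyLattice _ hz, ?_⟩
    rw [Matrix.inv_zpow' hA, neg_neg]
  · exact ⟨0, zero_mem _⟩
  · rintro x y ⟨j, hj⟩ ⟨k, hk⟩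
    exact ⟨min j k, add_mem (bFil_antitone hA (min_le_left _ _) hj)
      (bFil_antitone hA (min_le_right _ _) hk)⟩

theorem bNorm_eq {A : Matrix (Fin n) (Fin n) ℚ} (hA : IsUnit A.det) {y : ZLaurent A} {k : ℤ}
    (h1 : y.val ∈ bFil A k) (h2 : y.val ∉ bFil A (k + 1)) :
    bNorm y = (bIndex A : ℝ) ^ (-k) := by
  have h : ∃ k : ℤ, y.val ∈ bFil A k ∧ y.val ∉ bFil A (k + 1) := ⟨k, h1, h2⟩
  have hk : h.choose = k := by
    obtain ⟨h3, h4⟩ := h.choose_spec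
    refine le_antisymm ?_ ?_
    · by_contra hlt
      exact h2 (bFil_antitone hA (by omega) h3)
    · by_contra hlt
      exact h4 (bFil_antitone hA (by omega) h1)
  rw [bNorm, bVal, dif_pos h, hk]
  rfl

theorem bNorm_eq_zero {A : Matrix (Fin n) (Fin n) ℚ} {y : ZLaurent A}
    (h : ∀ k, y.val ∈ bFil A k) : bNorm y = 0 := by
  rw [bNorm, bVal, dif_neg]
  · rfl
  · rintro ⟨k, -, h2⟩
    exact h2 (h _)

theorem mem_all_or {A : Matrix (Fin n) (Fin n) ℚ} (hA : IsUnit A.det) (y : ZLaurent A) :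
    (∀ k, y.val ∈ bFil A k) ∨ ∃ k, y.val ∈ bFil A k ∧ y.val ∉ bFil A (k + 1) := by
  by_contra! hcon
  obtain ⟨⟨k, hk⟩, h2⟩ := hcon
  obtain ⟨j, hj⟩ := exists_mem_bFil hA y
  refine hk ?_
  have : ∀ m : ℕ, y.val ∈ bFil A (j + m) := by
    intro m
    induction m with
    | zero => simpa using hj
    | succ m ih => simpa [add_assoc] using h2 _ ih
  exact bFil_antitone hA (show k ≤ j + ((k - j).toNat : ℤ) by omega) (this _)

theorem bNorm_nonneg {A : Matrix (Fin n) (Fin n) ℚ} (hA : IsUnit A.det) (y : ZLaurent A) :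
    0 ≤ bNorm y := by
  rcases mem_all_or hA y with h | ⟨k, h1, h2⟩
  · rw [bNorm_eq_zero h]
  · rw [bNorm_eq hA h1 h2]
    positivity

theorem bNorm_le_iff {A : Matrix (Fin n) (Fin n) ℚ} (hA : IsUnit A.det) (hb : 2 ≤ bIndex A)
    {y : ZLaurent A} {j : ℤ} : bNorm y ≤ (bIndex A : ℝ) ^ (-j) ↔ y.val ∈ bFil A j := by
  have hb' : (1 : ℝ) < bIndex A := by exact_mod_cast hb
  rcases mem_all_or hA y with h | ⟨k, h1, h2⟩
  · rw [bNorm_eq_zero h]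
    exact iff_of_true (by positivity) (h j)
  · rw [bNorm_eq hA h1 h2, zpow_le_zpow_iff_right₀ hb']
    constructor
    · intro hjk
      exact bFil_antitone hA (by omega) h1
    · intro hj
      by_contra hlt
      exact h2 (bFil_antitone hA (by omega) hj)

theorem bNorm_add_le_max {A : Matrix (Fin n) (Fin n) ℚ} (hA : IsUnit A.det) (hb : 2 ≤ bIndex A)
    (x y : ZLaurent A) : bNorm (x + y) ≤ max (bNorm x) (bNorm y) := by
  wlog hxy : bNorm x ≤ bNorm y generalizing x y
  · rw [add_comm, max_comm]
    exact this y x (le_of_not_ge hxy)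
  rw [max_eq_right hxy]
  rcases mem_all_or hA y with h | ⟨k, h1, h2⟩
  · have hx : ∀ k, x.val ∈ bFil A k := fun k => by
      rw [← bNorm_le_iff hA hb]
      rw [bNorm_eq_zero h] at hxy
      exact hxy.trans (by positivity)
    rw [bNorm_eq_zero h, bNorm_eq_zero]
    intro k
    rw [map_add]
    exact add_mem (hx k) (h k)
  · rw [bNorm_eq hA h1 h2] at hxy ⊢
    rw [bNorm_le_iff hA hb] at hxy ⊢
    rw [map_add]
    exact add_mem hxy h1

theorem bNorm_neg {A : Matrix (Fin n) (Fin n) ℚ} (hA : IsUnit A.det) (y : ZLaurent A) :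
    bNorm (-y) = bNorm y := by
  have hneg : ∀ k, (-y).val ∈ bFil A k ↔ y.val ∈ bFil A k := fun k => by
    rw [map_neg, neg_mem_iff]
  rcases mem_all_or hA y with h | ⟨k, h1, h2⟩
  · rw [bNorm_eq_zero h, bNorm_eq_zero fun k => (hneg k).2 (h k)]
  · rw [bNorm_eq hA h1 h2, bNorm_eq hA ((hneg _).2 h1) (mt (hneg _).1 h2)]

theorem bNorm_zero (A : Matrix (Fin n) (Fin n) ℚ) : bNorm (0 : ZLaurent A) = 0 :=
  bNorm_eq_zero fun k => by simp

end Basics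

/-- Multiplication by `A ^ k` on `ℤⁿ(B)`. -/
def powZ (A : Matrix (Fin n) (Fin n) ℚ) [hA : Fact (IsExpanding A)] (k : ℤ) :
    ZLaurent A →+ ZLaurent A :=
  ((mulHom (A ^ k)).comp ZLaurent.val).codRestrict (laurentLattice A)
    fun x => zpow_mem_laurentLattice hA.out.isUnit_det k x.2

theorem val_powZ (A : Matrix (Fin n) (Fin n) ℚ) [hA : Fact (IsExpanding A)] (k : ℤ)
    (x : ZLaurent A) : (powZ A k x).val = mulHom (A ^ k) x.val := rfl

/-! ### The representation space -/

section Space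

variable (A : Matrix (Fin n) (Fin n) ℚ) [hA : Fact (IsExpanding A)] [hb : Fact (2 ≤ bIndex A)]

/-- The `B`-adic (pseudo-)metric `d(y, y') = b ^ (-ν(y - y'))` on `ℤⁿ(B)`. -/
instance : SeminormedAddCommGroup (ZLaurent A) :=
  AddGroupSeminorm.toSeminormedAddCommGroup
    { toFun := bNorm
      map_zero' := bNorm_zero A
      add_le' := fun x y => (bNorm_add_le_max hA.out.isUnit_det hb.out x y).trans
        (max_le_add_of_nonneg (bNorm_nonneg hA.out.isUnit_det x)
          (bNorm_nonneg hA.out.isUnit_det y))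
      neg' := bNorm_neg hA.out.isUnit_det }

theorem norm_def (y : ZLaurent A) : ‖y‖ = bNorm y := rfl

/-- The `B`-adic series `ℤⁿ((B))`: the (Hausdorff) completion of `ℤⁿ(B)`. -/
abbrev BSeries : Type := UniformSpace.Completion (ZLaurent A)

/-- The representation space `𝕂_A = ℝⁿ × ℤⁿ((B))`, with the maximum metric. -/
abbrev KSpace : Type := EuclideanSpace ℝ (Fin n) × BSeries A

/-- The diagonal embedding `φ : ℤⁿ(B) → 𝕂_A`, `x ↦ (x, x)`. -/
def phi (x : ZLaurent A) : KSpace A :=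
  (WithLp.toLp 2 fun i => ((x.val i : ℚ) : ℝ), (x : BSeries A))

/-- The image `φ(M)` of a set `M` of vectors of `ℤⁿ(B)`. -/
def phiImage (M : Set (Fin n → ℚ)) : Set (KSpace A) :=
  phi A '' {x | x.val ∈ M}

theorem norm_powZ (k : ℤ) (x : ZLaurent A) : ‖powZ A k x‖ = (bIndex A : ℝ) ^ k * ‖x‖ := by
  have hb0 : (bIndex A : ℝ) ≠ 0 := by
    have := hb.out
    positivity
  have hd := hA.out.isUnit_det
  have hiff : ∀ j, (powZ A k x).val ∈ bFil A (j - k) ↔ x.val ∈ bFil A j := fun j => by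
    constructor
    · intro h
      have := mem_bFil_zpow hd _ (-k) h
      rw [val_powZ, ← AddMonoidHom.comp_apply, ← mulHom_mul, Matrix.zpow_neg_mul_zpow_self _ hd,
        mulHom_one] at this
      simpa using this
    · exact mem_bFil_zpow hd j k
  rw [norm_def, norm_def]
  rcases mem_all_or hd x with h | ⟨j, h1, h2⟩
  · rw [bNorm_eq_zero h, bNorm_eq_zero, mul_zero]
    intro j
    have := (hiff (j + k)).2 (h _)
    simpa using this
  · rw [bNorm_eq hd h1 h2, bNorm_eq hd ((hiff j).2 h1), ← zpow_add₀ hb0]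
    · congr 1
      ring
    · rw [sub_add_eq_add_sub]
      exact mt (hiff _).1 h2

theorem continuous_powZ (k : ℤ) : Continuous (powZ A k) :=
  AddMonoidHomClass.continuous_of_bound (powZ A k) _ fun x => (norm_powZ A k x).le

/-- Multiplication by `A ^ k` on `ℤⁿ((B))`, extended by continuity from `ℤⁿ(B)`. -/
def powB (k : ℤ) : BSeries A →+ BSeries A := (powZ A k).completion (continuous_powZ A k)

theorem continuous_powB (k : ℤ) : Continuous (powB A k) :=
  AddMonoidHom.continuous_completion (powZ A k) (continuous_powZ A k)

theorem powB_coe (k : ℤ) (y : ZLaurent A) : powB A k (y : BSeries A) = (powZ A k y : ZLaurent A) :=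
  AddMonoidHom.completion_coe (powZ A k) (continuous_powZ A k) y

/-- The action of the matrix `A ^ k` on `𝕂_A`: `(x, y) ↦ (A ^ k x, A ^ k y)`. -/
def act (k : ℤ) : KSpace A →+ KSpace A :=
  ((Matrix.toEuclideanLin ((A ^ k).map (algebraMap ℚ ℝ))).toAddMonoidHom).prodMap (powB A k)

/-! ### The Haar measure -/

theorem relIndex_bFil_ne_zero (k : ℕ) : (bFil A k).relIndex (bFil A 0) ≠ 0 := by
  induction k with
  | zero => simp
  | succ k ih =>
    refine AddSubgroup.relIndex_ne_zero_trans (K := bFil A k) ?_ ih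
    have hd := hA.out.isUnit_det
    have hinj : Function.Injective (mulHom (A⁻¹ ^ (k : ℤ))) := by
      have hu := Matrix.isUnit_nonsing_inv_det A hd
      refine Function.LeftInverse.injective (g := mulHom (A⁻¹ ^ (-(k : ℤ)))) fun x => ?_
      rw [← AddMonoidHom.comp_apply, ← mulHom_mul, Matrix.zpow_neg_mul_zpow_self _ hu, mulHom_one]
      rfl
    rw [Nat.cast_succ, bFil_succ hd, bFil, AddSubgroup.relIndex_map_map_of_injective _ _ hinj]
    have := hb.out
    change bIndex A ≠ 0
    omega

theorem norm_le_one_iff {x : ZLaurent A} : ‖x‖ ≤ 1 ↔ x.val ∈ bFil A 0 := by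
  rw [← bNorm_le_iff hA.out.isUnit_det hb.out]
  simp [norm_def]

theorem norm_le_one_of_lt_two {x : ZLaurent A} (h : ‖x‖ < 2) : ‖x‖ ≤ 1 := by
  have hb' : (2 : ℝ) ≤ bIndex A := by exact_mod_cast hb.out
  rw [norm_def] at h ⊢
  rcases mem_all_or hA.out.isUnit_det x with h0 | ⟨k, h1, h2⟩
  · rw [bNorm_eq_zero h0]
    exact zero_le_one
  · rw [bNorm_eq hA.out.isUnit_det h1 h2] at h ⊢
    have : -k < 1 := by
      rw [← zpow_lt_zpow_iff_right₀ (show (1 : ℝ) < bIndex A by linarith)]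
      simpa using h.trans_le hb'
    exact zpow_le_one_of_nonpos₀ (by linarith) (by omega)

theorem totallyBounded_unitBall : TotallyBounded (Metric.closedBall (0 : ZLaurent A) 1) := by
  have hb' : (2 : ℝ) ≤ bIndex A := by exact_mod_cast hb.out
  have hd := hA.out.isUnit_det
  rw [Metric.totallyBounded_iff]
  intro ε hε
  obtain ⟨k, hk⟩ := exists_pow_lt_of_lt_one hε
    (show ((bIndex A : ℝ))⁻¹ < 1 from inv_lt_one_of_one_lt₀ (by linarith))
  have hfin : Finite (bFil A 0 ⧸ (bFil A k).addSubgroupOf (bFil A 0)) :=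
    Nat.finite_of_card_ne_zero (relIndex_bFil_ne_zero A k)
  have hle : ∀ q : bFil A 0, (q : Fin n → ℚ) ∈ laurentLattice A := fun q => by
    apply polyLattice_inv_le A hd
    rw [← bFil_zero]
    exact q.2
  let g : (bFil A 0 ⧸ (bFil A k).addSubgroupOf (bFil A 0)) → ZLaurent A :=
    fun q => ⟨(q.out : bFil A 0), hle _⟩
  refine ⟨Set.range g, Set.finite_range _, ?_⟩
  intro x hx
  rw [mem_closedBall_zero_iff, norm_le_one_iff] at hx
  let x' : bFil A 0 := ⟨x.val, hx⟩
  have hq : -(Quotient.out (x' : bFil A 0 ⧸ (bFil A k).addSubgroupOf (bFil A 0))) + x' ∈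
      (bFil A k).addSubgroupOf (bFil A 0) :=
    QuotientAddGroup.eq.1 (QuotientAddGroup.out_eq' _)
  refine Set.mem_biUnion ⟨(x' : bFil A 0 ⧸ (bFil A k).addSubgroupOf (bFil A 0)), rfl⟩ ?_
  rw [Metric.mem_ball, dist_eq_norm]
  refine lt_of_le_of_lt (b := bNorm (x - g x')) le_rfl (lt_of_le_of_lt ?_ hk)
  rw [inv_pow, ← zpow_natCast, ← zpow_neg, bNorm_le_iff hd hb.out]
  rw [AddSubgroup.mem_addSubgroupOf] at hq
  rw [neg_add_eq_sub] at hq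
  exact hq

theorem isCompact_unitBall : IsCompact (Metric.closedBall (0 : BSeries A) 1) := by
  have h1 : TotallyBounded (closure ((fun x : ZLaurent A => (x : BSeries A)) ''
      Metric.closedBall 0 1)) :=
    ((totallyBounded_unitBall A).image
      (UniformSpace.Completion.uniformContinuous_coe _)).closure
  refine (h1.subset ?_).isCompact_of_isClosed Metric.isClosed_closedBall
  intro y hy
  rw [Metric.mem_closure_iff]
  intro ε hε
  obtain ⟨x, hx⟩ := (UniformSpace.Completion.denseRange_coe (α := ZLaurent A)).exists_dist_lt y
    (lt_min hε one_pos)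
  refine ⟨x, ⟨x, ?_, rfl⟩, hx.trans_le (min_le_left _ _)⟩
  rw [mem_closedBall_zero_iff] at hy ⊢
  apply norm_le_one_of_lt_two
  have h2 : ‖(x : BSeries A) - y‖ < 1 := by
    rw [← dist_eq_norm, dist_comm]
    exact hx.trans_le (min_le_right _ _)
  rw [← UniformSpace.Completion.norm_coe x]
  calc ‖(x : BSeries A)‖ = ‖((x : BSeries A) - y) + y‖ := by rw [sub_add_cancel]
    _ ≤ ‖(x : BSeries A) - y‖ + ‖y‖ := norm_add_le _ _
    _ < 2 := by linarith

instance : MeasurableSpace (BSeries A) := borel _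

instance : BorelSpace (BSeries A) := ⟨rfl⟩

/-- `ℤⁿ[[B]]`, the set of points of `ℤⁿ((B))` of nonnegative valuation, that is, the closed unit
ball. -/
def integerBall : TopologicalSpace.PositiveCompacts (BSeries A) where
  carrier := Metric.closedBall 0 1
  isCompact' := isCompact_unitBall A
  interior_nonempty' := ⟨0, Metric.ball_subset_interior_closedBall (Metric.mem_ball_self one_pos)⟩

/-- The `B`-adic measure: the Haar measure on `ℤⁿ((B))` with `μ_B(ℤⁿ[[B]]) = 1`. -/
def muB : Measure (BSeries A) := Measure.addHaarMeasure (integerBall A)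

/-- The Haar measure `μ = λ × μ_B` on `𝕂_A`. -/
def mu : Measure (KSpace A) := (volume : Measure (EuclideanSpace ℝ (Fin n))).prod (muB A)

/-! ### The self-affine set `F(A, D)` -/

theorem act_add (j k : ℤ) (p : KSpace A) : act A (j + k) p = act A j (act A k p) := by
  have hd := hA.out.isUnit_det
  obtain ⟨x, y⟩ := p
  refine Prod.ext ?_ ?_
  · change Matrix.toEuclideanLin _ x = Matrix.toEuclideanLin _ (Matrix.toEuclideanLin _ x)
    have : (A ^ (j + k)).map (algebraMap ℚ ℝ) =
        (A ^ j).map (algebraMap ℚ ℝ) * (A ^ k).map (algebraMap ℚ ℝ) := by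
      rw [Matrix.zpow_add hd, Matrix.map_mul]
    rw [this]
    simp [Matrix.toEuclideanLin, Matrix.toLpLin_apply, Matrix.mulVec_mulVec]
  · change powB A (j + k) y = powB A j (powB A k y)
    induction y using UniformSpace.Completion.induction_on with
    | hp =>
      exact isClosed_eq (continuous_powB A _)
        ((continuous_powB A _).comp (continuous_powB A _))
    | ih y =>
      rw [powB_coe, powB_coe, powB_coe]
      congr 1
      apply Subtype.ext
      change mulHom (A ^ (j + k)) y.val = mulHom (A ^ j) (mulHom (A ^ k) y.val)
      rw [Matrix.zpow_add hd, mulHom_mul]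
      rfl

theorem act_zero (p : KSpace A) : act A 0 p = p := by
  obtain ⟨x, y⟩ := p
  refine Prod.ext ?_ ?_
  · change Matrix.toEuclideanLin _ x = x
    simp
  · change powB A 0 y = y
    induction y using UniformSpace.Completion.induction_on with
    | hp => exact isClosed_eq (continuous_powB A _) continuous_id
    | ih y =>
      rw [powB_coe]
      congr 1
      apply Subtype.ext
      change mulHom (A ^ (0 : ℤ)) y.val = y.val
      rw [zpow_zero, mulHom_one]
      rfl

theorem continuous_act (k : ℤ) : Continuous (act A k) :=
  Continuous.prodMk
    ((LinearMap.continuous_of_finiteDimensional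
      (Matrix.toEuclideanLin ((A ^ k).map (algebraMap ℚ ℝ)))).comp continuous_fst)
    ((continuous_powB A k).comp continuous_snd)

theorem norm_powB (k : ℤ) (y : BSeries A) :
    ‖powB A k y‖ = (bIndex A : ℝ) ^ k * ‖y‖ := by
  induction y using UniformSpace.Completion.induction_on with
  | hp =>
    exact isClosed_eq (continuous_powB A k).norm
      (continuous_const.mul continuous_norm)
  | ih y => rw [powB_coe, UniformSpace.Completion.norm_coe, norm_powZ,
      UniformSpace.Completion.norm_coe]

theorem norm_real_le (M : Matrix (Fin n) (Fin n) ℚ) (x : EuclideanSpace ℝ (Fin n)) :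
    ‖Matrix.toEuclideanLin (M.map (algebraMap ℚ ℝ)) x‖ ≤
      ‖Matrix.toEuclideanCLM (n := Fin n) (𝕜 := ℂ) (M.map (algebraMap ℚ ℂ))‖ * ‖x‖ := by
  let c : EuclideanSpace ℝ (Fin n) → EuclideanSpace ℂ (Fin n) :=
    fun x => WithLp.toLp 2 fun i => (x i : ℂ)
  have hc : ∀ x, ‖c x‖ = ‖x‖ := fun x => by
    simp [c, EuclideanSpace.norm_eq]
  have hM : c (Matrix.toEuclideanLin (M.map (algebraMap ℚ ℝ)) x) =
      Matrix.toEuclideanCLM (n := Fin n) (𝕜 := ℂ) (M.map (algebraMap ℚ ℂ)) (c x) := by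
    ext i
    simp [c, Matrix.mulVec, dotProduct]
  rw [← hc, hM, ← hc x]
  exact ContinuousLinearMap.le_opNorm _ _

theorem exists_real_bound (A : Matrix (Fin n) (Fin n) ℚ) (hA : IsExpanding A) :
    ∃ C r : ℝ, 0 ≤ r ∧ r < 1 ∧ ∀ (k : ℕ) (x : EuclideanSpace ℝ (Fin n)),
      ‖Matrix.toEuclideanLin ((A ^ (-(k : ℤ))).map (algebraMap ℚ ℝ)) x‖ ≤ C * r ^ k * ‖x‖ := by
  rcases Nat.eq_zero_or_pos n with rfl | hn
  · refine ⟨0, 0, le_rfl, one_pos, fun k x => ?_⟩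
    rw [Subsingleton.elim x 0]
    simp
  have : Nonempty (Fin n) := ⟨⟨0, hn⟩⟩
  have hd := hA.isUnit_det
  let Ac : Matrix (Fin n) (Fin n) ℂ := A.map (algebraMap ℚ ℂ)
  let Bc : Matrix (Fin n) (Fin n) ℂ := A⁻¹.map (algebraMap ℚ ℂ)
  have hAB : Ac * Bc = 1 := by
    rw [← Matrix.map_mul, Matrix.mul_nonsing_inv _ hd]
    simp
  have hBA : Bc * Ac = 1 := by
    rw [← Matrix.map_mul, Matrix.nonsing_inv_mul _ hd]
    simp
  let T : EuclideanSpace ℂ (Fin n) →L[ℂ] EuclideanSpace ℂ (Fin n) :=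
    Matrix.toEuclideanCLM (n := Fin n) (𝕜 := ℂ) Bc
  have hspec : ∀ z ∈ spectrum ℂ T, ‖z‖₊ < 1 := by
    intro z hz
    rw [AlgEquiv.spectrum_eq (Matrix.toEuclideanCLM (n := Fin n) (𝕜 := ℂ))] at hz
    have hu : IsUnit Bc := ⟨⟨Bc, Ac, hBA, hAB⟩, rfl⟩
    have hz0 : z ≠ 0 := spectrum.ne_zero_of_mem_of_unit (a := hu.unit) hz
    have h2 : z⁻¹ ∈ spectrum ℂ Ac := by
      let u : (Matrix (Fin n) (Fin n) ℂ)ˣ := ⟨Bc, Ac, hBA, hAB⟩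
      exact spectrum.inv₀_mem_inv_iff (a := u) |>.2 hz
    have h3 := hA _ h2
    rw [norm_inv] at h3
    have h4 : ‖z‖ < 1 := (one_lt_inv₀ (norm_pos_iff.2 hz0)).1 h3
    exact_mod_cast h4
  have hrad : spectralRadius ℂ T < (1 : NNReal) :=
    spectrum.spectralRadius_lt_of_forall_lt T hspec
  obtain ⟨r, hr1, hr2⟩ := ENNReal.lt_iff_exists_nnreal_btwn.1 hrad
  have hev := (spectrum.pow_nnnorm_pow_one_div_tendsto_nhds_spectralRadius T).eventually_lt_const hr1
  have hr0 : 0 < r := by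
    rw [← ENNReal.coe_pos]
    exact lt_of_le_of_lt zero_le hr1
  have hr2' : r < 1 := by exact_mod_cast hr2
  obtain ⟨N, hN⟩ := eventually_atTop.1 (hev.and (eventually_gt_atTop 0))
  have hpow : ∀ k ≥ N, ‖T ^ k‖₊ ≤ r ^ k := by
    intro k hk
    obtain ⟨h1, h2⟩ := hN k hk
    have h3 : ((‖T ^ k‖₊ : ENNReal) ^ (1 / k : ℝ)) ^ (k : ℝ) ≤ (r : ENNReal) ^ (k : ℝ) :=
      ENNReal.rpow_le_rpow h1.le (by positivity)
    rw [← ENNReal.rpow_mul, one_div, inv_mul_cancel₀ (by positivity), ENNReal.rpow_one,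
      ENNReal.rpow_natCast] at h3
    exact_mod_cast h3
  let C : ℝ := 1 + ∑ k ∈ Finset.range N, ‖T ^ k‖ / (r : ℝ) ^ k
  have hsum : 0 ≤ ∑ k ∈ Finset.range N, ‖T ^ k‖ / (r : ℝ) ^ k :=
    Finset.sum_nonneg fun _ _ => by positivity
  refine ⟨C, r, r.2, hr2', fun k x => (norm_real_le _ _).trans ?_⟩
  have hT : Matrix.toEuclideanCLM (n := Fin n) (𝕜 := ℂ)
      ((A ^ (-(k : ℤ))).map (algebraMap ℚ ℂ)) = T ^ k := by
    rw [← map_pow, Matrix.zpow_neg hd, zpow_natCast, ← Matrix.inv_pow']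
    congr 1
    exact (Matrix.map_pow A⁻¹ (algebraMap ℚ ℂ) k)
  rw [hT]
  refine mul_le_mul_of_nonneg_right ?_ (norm_nonneg _)
  rcases lt_or_ge k N with hk | hk
  · have h1 : ‖T ^ k‖ / (r : ℝ) ^ k ≤ C := by
      refine le_trans (Finset.single_le_sum (f := fun k => ‖T ^ k‖ / (r : ℝ) ^ k)
        (fun _ _ => by positivity) (Finset.mem_range.2 hk)) ?_
      simp [C]
    rwa [div_le_iff₀ (by positivity)] at h1
  · have h1 : ‖T ^ k‖ ≤ (r : ℝ) ^ k := by exact_mod_cast hpow k hk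
    refine h1.trans (le_mul_of_one_le_left (by positivity) ?_)
    simp only [C]
    linarith

/-- `A⁻¹` is eventually a contraction of `𝕂_A`, at an exponential rate. -/
theorem exists_bound : ∃ C r : ℝ, 0 ≤ C ∧ 0 ≤ r ∧ r < 1 ∧ ∀ (k : ℕ) (p : KSpace A),
    ‖act A (-(k : ℤ)) p‖ ≤ C * r ^ k * ‖p‖ := by
  obtain ⟨C, r, hr0, hr1, h⟩ := exists_real_bound A hA.out
  have hb' : (2 : ℝ) ≤ bIndex A := by exact_mod_cast hb.out
  refine ⟨max C 1, max r (1 / 2), by positivity, le_max_of_le_left hr0, max_lt hr1 (by norm_num), fun k p => ?_⟩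
  obtain ⟨x, y⟩ := p
  rw [Prod.norm_def]
  refine max_le ?_ ?_
  · refine (h k x).trans ?_
    gcongr
    · exact le_max_left _ _
    · exact le_max_left _ _
    · exact le_max_left ‖x‖ ‖y‖
  · change ‖powB A (-(k : ℤ)) y‖ ≤ _
    rw [norm_powB, zpow_neg, zpow_natCast, ← inv_pow]
    have h1 : ((bIndex A : ℝ))⁻¹ ≤ max r (1 / 2) := by
      refine le_trans ?_ (le_max_right _ _)
      rw [one_div]
      exact inv_anti₀ (by norm_num) hb'
    calc ((bIndex A : ℝ))⁻¹ ^ k * ‖y‖ ≤ 1 * (max r (1 / 2)) ^ k * ‖y‖ := by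
          rw [one_mul]
          gcongr
      _ ≤ _ := by
          gcongr
          · exact le_max_right _ _
          · exact le_max_right ‖x‖ ‖y‖

/-- The translate `F + s`. -/
def translate {A : Matrix (Fin n) (Fin n) ℚ} [Fact (IsExpanding A)] [Fact (2 ≤ bIndex A)]
    (F : Set (KSpace A)) (s : KSpace A) : Set (KSpace A) := (fun p => p + s) '' F

theorem existsUnique_of_finite (E : Set (KSpace A)) (hE : E.Finite) (hE' : E.Nonempty) :
    ∃! F : Set (KSpace A), F.Nonempty ∧ IsCompact F ∧
      act A 1 '' F = ⋃ p ∈ E, translate F p := by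
  obtain ⟨C, r, hC0, hr0, hr1, hC⟩ := exists_bound A
  have : CompactSpace E := isCompact_iff_compactSpace.1 hE.isCompact
  have : Nonempty E := hE'.to_subtype
  obtain ⟨R, hR⟩ := hE.isBounded.exists_norm_le
  have hgeo : Summable fun j : ℕ => C * r ^ (j + 1) * R :=
    (((summable_geometric_of_lt_one hr0 hr1).comp_injective
      (add_left_injective 1)).mul_left C).mul_right R
  let t : (ℕ → E) → ℕ → KSpace A := fun d j => act A (-((j + 1 : ℕ) : ℤ)) (d j)
  have hterm : ∀ j d, ‖t d j‖ ≤ C * r ^ (j + 1) * R := fun j d =>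
    (hC (j + 1) (d j)).trans (mul_le_mul_of_nonneg_left (hR _ (d j).2) (by positivity))
  have hsum : ∀ d, Summable (t d) := fun d => Summable.of_norm_bounded hgeo fun j => hterm j d
  let G : (ℕ → E) → KSpace A := fun d => ∑' j, t d j
  have hG : Continuous G := continuous_tsum (fun j => (continuous_act A _).comp
    (continuous_subtype_val.comp (continuous_apply j))) hgeo hterm
  have hinv : ∀ p, act A (-1) (act A 1 p) = p := fun p => by
    rw [← act_add, neg_add_cancel, act_zero]
  have hinv' : ∀ p, act A 1 (act A (-1) p) = p := fun p => by
    rw [← act_add, add_neg_cancel, act_zero]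
  have hshift : ∀ d, act A 1 (G d) = G (fun j => d (j + 1)) + d 0 := by
    intro d
    have h1 := ((hsum d).hasSum.map (act A 1) (continuous_act A 1)).tsum_eq
    change act A 1 (∑' j, t d j) = _
    rw [← h1, (((hsum d).hasSum.map (act A 1) (continuous_act A 1)).summable).tsum_eq_zero_add,
      add_comm]
    congr 1
    · refine tsum_congr fun j => ?_
      change act A 1 (act A _ _) = act A _ _
      rw [← act_add]
      congr 2
    · change act A 1 (act A _ _) = _
      exact hinv' _
  refine ⟨Set.range G, ⟨Set.range_nonempty _, isCompact_range hG, ?_⟩, ?_⟩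
  · ext p
    simp only [Set.mem_image, Set.mem_range, exists_exists_eq_and, Set.mem_iUnion, translate,
      exists_prop]
    constructor
    · rintro ⟨d, rfl⟩
      exact ⟨d 0, (d 0).2, fun j => d (j + 1), (hshift d).symm⟩
    · rintro ⟨e, he, d, rfl⟩
      let d' : ℕ → E := fun j => Nat.casesOn j ⟨e, he⟩ d
      have h0 : d' 0 = ⟨e, he⟩ := rfl
      have h1 : (fun j => d' (j + 1)) = d := rfl
      have h2 := hshift d'
      rw [h0, h1] at h2
      exact ⟨d', h2⟩
  · rintro X ⟨hX, hXc, hXe⟩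
    obtain ⟨S, hS⟩ := hXc.isBounded.exists_norm_le
    have hzero : ∀ x : ℕ → KSpace A, (∀ k, x k ∈ X) →
        Tendsto (fun k : ℕ => act A (-(k : ℤ)) (x k)) atTop (𝓝 0) := by
      intro x hx
      have h0 : Tendsto (fun k : ℕ => C * r ^ k * S) atTop (𝓝 0) := by
        simpa using ((tendsto_pow_atTop_nhds_zero_of_lt_one hr0 hr1).const_mul C).mul_const S
      exact squeeze_zero_norm (fun k => (hC k (x k)).trans
        (mul_le_mul_of_nonneg_left (hS _ (hx k)) (by positivity))) h0
    apply Set.Subset.antisymm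
    · have hstep : ∀ x : X, ∃ e : E, ∃ y : X, act A 1 (x : KSpace A) = y + e := by
        intro x
        have h1 : act A 1 (x : KSpace A) ∈ ⋃ p ∈ E, translate X p := hXe ▸ ⟨x, x.2, rfl⟩
        simp only [Set.mem_iUnion, translate, exists_prop] at h1
        obtain ⟨e, he, y, hy, hye⟩ := h1
        exact ⟨⟨e, he⟩, ⟨y, hy⟩, hye.symm⟩
      choose dig nxt hdn using hstep
      intro x hx
      let o : ℕ → X := fun k => nxt^[k] ⟨x, hx⟩
      refine ⟨fun k => dig (o k), ?_⟩
      have hpart : ∀ k : ℕ, x = ∑ j ∈ Finset.range k, t (fun k => dig (o k)) j +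
          act A (-(k : ℤ)) (o k) := by
        intro k
        induction k with
        | zero => simp [act_zero, o]
        | succ k ih =>
          rw [Finset.sum_range_succ]
          nth_rewrite 1 [ih]
          rw [add_assoc]
          congr 1
          change _ = act A (-((k + 1 : ℕ) : ℤ)) (dig (o k)) + act A (-((k + 1 : ℕ) : ℤ)) (o (k + 1))
          rw [← map_add, add_comm (dig (o k) : KSpace A)]
          have : (o (k + 1) : KSpace A) + dig (o k) = act A 1 (o k) := by
            rw [hdn]
            simp only [o, Function.iterate_succ_apply']
          rw [this, ← act_add]
          congr 2
          push_cast
          ring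
      have h1 := ((hsum fun k => dig (o k)).hasSum.tendsto_sum_nat).add
        (hzero (fun k => (o k : KSpace A)) fun k => (o k).2)
      rw [add_zero] at h1
      refine tendsto_nhds_unique h1 ?_
      simp_rw [← hpart]
      exact tendsto_const_nhds
    · rintro _ ⟨d, rfl⟩
      obtain ⟨x0, hx0⟩ := hX
      have hback : ∀ p ∈ X, ∀ e : E, act A (-1) (p + e) ∈ X := by
        intro p hp e
        have h1 : p + (e : KSpace A) ∈ act A 1 '' X := by
          rw [hXe]
          exact Set.mem_biUnion e.2 ⟨p, hp, rfl⟩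
        obtain ⟨q, hq, hqe⟩ := h1
        rw [← hqe, hinv]
        exact hq
      have hpart : ∀ (k : ℕ) (d : ℕ → E),
          ∑ j ∈ Finset.range k, t d j + act A (-(k : ℤ)) x0 ∈ X := by
        intro k
        induction k with
        | zero => intro d; simpa [act_zero] using hx0
        | succ k ih =>
          intro d
          have h1 := hback _ (ih fun j => d (j + 1)) (d 0)
          rw [map_add, map_add, map_sum, ← act_add] at h1
          convert h1 using 1
          rw [Finset.sum_range_succ', add_right_comm]
          congr 1
          congr 1
          · refine Finset.sum_congr rfl fun j _ => ?_
            change act A _ _ = act A _ (act A _ _)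
            rw [← act_add]
            congr 2
            push_cast
            ring
          · congr 2
            push_cast
            ring
      have h1 := ((hsum d).hasSum.tendsto_sum_nat).add (hzero (fun _ => x0) fun _ => hx0)
      rw [add_zero] at h1
      exact hXc.isClosed.mem_of_tendsto h1 (Eventually.of_forall fun k => hpart k d)

end Space

theorem aIndex_ne_zero {A : Matrix (Fin n) (Fin n) ℚ} (hA : IsUnit A.det) : aIndex A ≠ 0 := by
  have hP : polyLattice A = intLattice n ⊔ (polyLattice A).map (mulHom A) := by
    refine le_antisymm (iSup_le fun k => ?_)
      (sup_le (intLattice_le_polyLattice A) (map_polyLattice_le A))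
    cases k with
    | zero => simp [mulHom_one]
    | succ k =>
      refine le_trans ?_ le_sup_right
      rw [pow_succ', mulHom_mul, ← AddSubgroup.map_map]
      exact AddSubgroup.map_mono (le_iSup (fun k : ℕ => (intLattice n).map (mulHom (A ^ k))) k)
  have hrel : aIndex A = ((polyLattice A).map (mulHom A)).relIndex (intLattice n) := by
    rw [aIndex]
    calc _ = ((polyLattice A).map (mulHom A)).relIndex
          (intLattice n ⊔ (polyLattice A).map (mulHom A)) := by rw [← hP]
      _ = _ := AddSubgroup.relIndex_sup_right _ _
  rw [hrel]
  let m : ℕ := ∏ i, ∏ j, (A⁻¹ i j).den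
  have hm : m ≠ 0 := Finset.prod_ne_zero_iff.2 fun i _ =>
    Finset.prod_ne_zero_iff.2 fun j _ => (A⁻¹ i j).den_nz
  have hint : ∀ i j, ∃ c : ℤ, (c : ℚ) = m * A⁻¹ i j := by
    intro i j
    obtain ⟨c, hc⟩ : (A⁻¹ i j).den ∣ m :=
      (Finset.dvd_prod_of_mem (fun j => (A⁻¹ i j).den) (Finset.mem_univ j)).trans
        (Finset.dvd_prod_of_mem (fun i => ∏ j, (A⁻¹ i j).den) (Finset.mem_univ i))
    refine ⟨c * (A⁻¹ i j).num, ?_⟩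
    rw [hc]
    push_cast
    rw [mul_comm ((A⁻¹ i j).den : ℚ), mul_assoc, Rat.den_mul_eq_num]
  have hmul : ∀ z ∈ intLattice n, m • z ∈ (polyLattice A).map (mulHom A) := by
    intro z hz
    refine ⟨mulHom A⁻¹ (m • z), intLattice_le_polyLattice A ?_, ?_⟩
    · rw [mem_intLattice] at hz ⊢
      choose w hw using hz
      choose c hc using hint
      intro i
      refine ⟨∑ j, c i j * w j, ?_⟩
      push_cast
      rw [mulHom_apply, Matrix.mulVec, dotProduct]
      refine Finset.sum_congr rfl fun j _ => ?_
      rw [hc, hw]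
      simp
      ring
    · rw [← AddMonoidHom.comp_apply, ← mulHom_mul, Matrix.mul_nonsing_inv _ hA, mulHom_one]
      rfl
  have hfg : AddGroup.FG (intLattice n) := by
    let f : (Fin n → ℤ) →+ (Fin n → ℚ) := (Int.castAddHom ℚ).compLeft (Fin n)
    have hf : f.range = intLattice n := by
      ext x
      rw [mem_intLattice, AddMonoidHom.mem_range]
      constructor
      · rintro ⟨w, rfl⟩ i
        exact ⟨w i, rfl⟩
      · intro h
        choose w hw using h
        exact ⟨w, funext hw⟩
    have hfgZ : AddGroup.FG (Fin n → ℤ) := Module.Finite.iff_addGroup_fg.1 inferInstance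
    rw [← hf]
    exact AddGroup.fg_of_surjective f.rangeRestrict_surjective
  have htor : IsAddTorsion
      (intLattice n ⧸ ((polyLattice A).map (mulHom A)).addSubgroupOf (intLattice n)) := by
    intro q
    induction q using QuotientAddGroup.induction_on with
    | H z =>
      rw [isOfFinAddOrder_iff_nsmul_eq_zero]
      refine ⟨m, Nat.pos_of_ne_zero hm, ?_⟩
      rw [← QuotientAddGroup.mk_nsmul, QuotientAddGroup.eq_zero_iff,
        AddSubgroup.mem_addSubgroupOf]
      exact hmul z z.2
  have : AddGroup.FG
      (intLattice n ⧸ ((polyLattice A).map (mulHom A)).addSubgroupOf (intLattice n)) :=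
    AddGroup.fg_of_surjective (QuotientAddGroup.mk'_surjective _)
  have := AddCommGroup.finite_of_fg_isAddTorsion _ htor
  exact Nat.card_ne_zero.2 ⟨inferInstance, this⟩

section Tile

variable (A : Matrix (Fin n) (Fin n) ℚ) [hA : Fact (IsExpanding A)] [hb : Fact (2 ≤ bIndex A)]

/-- `D` is a digit set for the base `A`: `D ⊆ ℤⁿ[A]` and `|D| = |ℤⁿ[A] / A ℤⁿ[A]|`. -/
structure IsDigitSet {n : ℕ} (A : Matrix (Fin n) (Fin n) ℚ) (D : Finset (Fin n → ℚ)) : Prop where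
  mem_polyLattice : ∀ d ∈ D, d ∈ polyLattice A
  card_eq : D.card = aIndex A

/-- `F` is nonempty and compact and satisfies the set equation `A F = ⋃_{d ∈ D} (F + φ(d))`. -/
def IsSelfAffine (D : Finset (Fin n → ℚ)) (F : Set (KSpace A)) : Prop :=
  F.Nonempty ∧ IsCompact F ∧ act A 1 '' F = ⋃ p ∈ phiImage A (D : Set (Fin n → ℚ)), translate F p

theorem existsUnique_isSelfAffine {D : Finset (Fin n → ℚ)} (hD : IsDigitSet A D) :
    ∃! F, IsSelfAffine A D F := by
  refine existsUnique_of_finite A (phiImage A D) (Set.Finite.image _ ?_) ?_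
  · exact D.finite_toSet.preimage Subtype.val_injective.injOn
  · have hne : D.Nonempty := by
      rw [← Finset.card_pos, hD.card_eq]
      exact Nat.pos_of_ne_zero (aIndex_ne_zero hA.out.isUnit_det)
    obtain ⟨d, hd⟩ := hne
    exact ⟨_, ⟨d, polyLattice_le A (hD.mem_polyLattice d hd)⟩, hd, rfl⟩

variable {A}

/-- The set `F = F(A, D)`: the unique nonempty compact subset of `𝕂_A` with
`A F = ⋃_{d ∈ D} (F + φ(d))`. -/
def tile {D : Finset (Fin n → ℚ)} (hD : IsDigitSet A D) : Set (KSpace A) :=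
  (existsUnique_isSelfAffine A hD).choose

theorem tile_spec {D : Finset (Fin n → ℚ)} (hD : IsDigitSet A D) :
    IsSelfAffine A D (tile hD) :=
  (existsUnique_isSelfAffine A hD).choose_spec.1

theorem tile_unique {D : Finset (Fin n → ℚ)} (hD : IsDigitSet A D) {F : Set (KSpace A)}
    (hF : IsSelfAffine A D F) : F = tile hD :=
  (existsUnique_isSelfAffine A hD).choose_spec.2 F hF

/-- `D_k = {d₀ + A d₁ + ⋯ + A ^ (k - 1) d_{k - 1} | d₀, …, d_{k - 1} ∈ D}`. -/
def blocks {n : ℕ} (A : Matrix (Fin n) (Fin n) ℚ) (D : Finset (Fin n → ℚ)) (k : ℕ) :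
    Set (Fin n → ℚ) :=
  {x | ∃ d : Fin k → Fin n → ℚ, (∀ i, d i ∈ D) ∧ x = ∑ i : Fin k, mulHom (A ^ (i : ℕ)) (d i)}

variable (A) in
/-- `Δ = ⋃_{k ≥ 1} φ(D_k - D_k)`. -/
def delta (D : Finset (Fin n → ℚ)) : Set (KSpace A) :=
  ⋃ k : ℕ, ⋃ _ : 1 ≤ k, phiImage A (blocks A D k - blocks A D k)

/-! ### Tilings -/

/-- `F + S` is a tiling of `𝕂_A`: it covers `𝕂_A`, and distinct translates intersect in a
null set. -/
structure IsTiling (F S : Set (KSpace A)) : Prop where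
  covers : ⋃ s ∈ S, translate F s = Set.univ
  null_inter : ∀ s ∈ S, ∀ s' ∈ S, s ≠ s' → mu A (translate F s ∩ translate F s') = 0

/-- An expanding linear map of `𝕂_A`: a bijective continuous additive map that commutes with the
action of `A` and whose iterates expand all distances at a common exponential rate. -/
structure IsExpandingLinear (T : KSpace A →+ KSpace A) : Prop where
  continuous : Continuous T
  bijective : Function.Bijective T
  commutes : ∀ p, T (act A 1 p) = act A 1 (T p)
  expands : ∃ c r : ℝ, 0 < c ∧ 1 < r ∧
    ∀ (m : ℕ) (p q : KSpace A), c * r ^ m * dist p q ≤ dist (T^[m] p) (T^[m] q)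

/-- `F + S` is a self-replicating tiling of `𝕂_A` with associated expanding linear map `T`. -/
structure IsSelfReplicating (T : KSpace A →+ KSpace A) (F S : Set (KSpace A)) : Prop where
  isTiling : IsTiling F S
  isExpandingLinear : IsExpandingLinear T
  exists_finite : ∀ s ∈ S, ∃ J : Set (KSpace A), J ⊆ S ∧ J.Finite ∧
    T '' translate F s = ⋃ s' ∈ J, translate F s'

/-- `F + S` is an atomic self-replicating tiling: the origin lies in exactly one tile. -/
structure IsAtomicSelfReplicating (T : KSpace A →+ KSpace A) (F S : Set (KSpace A)) : Prop
    extends IsSelfReplicating T F S where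
  atomic : ∃! s, s ∈ S ∧ 0 ∈ translate F s

end Tile

end RationalTile

end

open Set Filter Topology MeasureTheory
open scoped Pointwise

noncomputable section

namespace RationalTile

/-! Everything rests on one measure estimate and one well-chosen point. The estimate: `A` multiplies
the Haar measure of `𝕂_A` by at least `a`. Its real part contributes `|det A|`, its `B`-adic part at
least `b`, and `a ≤ |det A| b` is a comparison of indices of lattices (`aIndex_le_det_mul_bIndex`,
`aIndex_mul_le_mu_image`). Now `A ^ k F` is a union of at most `a ^ k` translates of `F` and has
measure at least `a ^ k μ(F)`, so there is no room for overlaps: distinct translates of `F` by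
points of `φ(D_k)` meet in null sets (`mu_inter_eq_zero`). Hence so do `F + s` and `F + s'` whenever
`s - s' ∈ Δ`.

The point: for large `k`, some piece `A ^ (-k) (F + d)` of `F`, with `d ∈ φ(D_k)`, lies inside the
interior of `F`. The contraction `q ↦ A ^ (-k) (q + d)` then has an interior fixed point `x`, so `A
^ k x = x + d` (`exists_periodic_interior`). Since `x` is interior, the sets `A ^ (k m) (F - x)`
exhaust the space. Each is a union of tiles of `F - x`, translated by the elements of `φ(D_{km}) -
e_m`, where `e_m = A ^ (k m) x - x = d + A ^ k d + ⋯ + A ^ (k (m - 1)) d`. These finite sets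
increase with `m`. Their union `S` lies in `Δ` because `e_m ∈ φ(D_{km})`; it gives a tiling, and
moving `x` to the origin makes the tiling self-replicating under `A ^ k`.

It is atomic because the origin is interior to the tile `F - x`, while `F` has positive measure near
each of its points, so a second tile through the origin would overlap the first one. If `Δ` is a
group, `F + Δ` covers because `S ⊆ Δ`, and the overlaps are null because `Δ - Δ ⊆ Δ`. -/

variable {n : ℕ}

/-! ### Integral matrices and indices in `ℤⁿ` -/

/-- Multiplication by an invertible matrix is injective. -/
theorem mulHom_injective {M : Matrix (Fin n) (Fin n) ℚ} (hM : IsUnit M.det) :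
    Function.Injective (mulHom M) := by
  refine Function.LeftInverse.injective (g := mulHom M⁻¹) fun x => ?_
  rw [← AddMonoidHom.comp_apply, ← mulHom_mul, Matrix.nonsing_inv_mul _ hM, mulHom_one]
  rfl

theorem intLattice_eq_closure :
    intLattice n = AddSubgroup.closure (Set.range (Pi.basisFun ℚ (Fin n))) := by
  refine le_antisymm (fun x hx => ?_) ?_
  · rw [mem_intLattice] at hx
    choose w hw using hx
    have hsum : x = ∑ i, w i • Pi.basisFun ℚ (Fin n) i := by
      ext j
      simp [Pi.single_apply, hw]
    rw [hsum]
    exact sum_mem fun i _ =>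
      zsmul_mem (AddSubgroup.subset_closure (Set.mem_range_self i)) _
  · rw [AddSubgroup.closure_le]
    rintro _ ⟨i, rfl⟩
    rw [SetLike.mem_coe, mem_intLattice]
    intro j
    refine ⟨if j = i then 1 else 0, ?_⟩
    simp [Pi.single_apply]

/-- The index in `ℤⁿ` of its image under an integral matrix is the absolute value of the
determinant. -/
theorem relIndex_map_intLattice {M : Matrix (Fin n) (Fin n) ℚ} (hM : IsUnit M.det)
    (hle : (intLattice n).map (mulHom M) ≤ intLattice n) :
    (((intLattice n).map (mulHom M)).relIndex (intLattice n) : ℚ) = |M.det| := by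
  let e : (Fin n → ℚ) ≃ₗ[ℚ] (Fin n → ℚ) :=
    LinearEquiv.ofIsUnitDet (f := M.mulVecLin) (v := Pi.basisFun ℚ (Fin n))
      (v' := Pi.basisFun ℚ (Fin n)) (by
        rw [← Matrix.toLin'_apply', LinearMap.toMatrix_eq_toMatrix', LinearMap.toMatrix'_toLin']
        exact hM)
  have he : ∀ x, e x = mulHom M x := fun x => rfl
  rw [AddSubgroup.relIndex_eq_abs_det _ _ hle ((Pi.basisFun ℚ (Fin n)).map e)
    (Pi.basisFun ℚ (Fin n)) ?_ intLattice_eq_closure]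
  · congr 1
    rw [Module.Basis.det_apply]
    congr 1
    ext i j
    simp [Module.Basis.toMatrix_apply, he, mulHom_apply]
  · rw [intLattice_eq_closure, AddMonoidHom.map_closure, ← Set.range_comp]
    congr 1

/-- The product of the denominators of all entries clears them. -/
theorem exists_nsmul_map_intLattice_le (M : Matrix (Fin n) (Fin n) ℚ) :
    ∃ m : ℕ, m ≠ 0 ∧ (intLattice n).map (mulHom ((m : ℚ) • M)) ≤ intLattice n := by
  let m : ℕ := ∏ i, ∏ j, (M i j).den
  have hm : m ≠ 0 := Finset.prod_ne_zero_iff.2 fun i _ =>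
    Finset.prod_ne_zero_iff.2 fun j _ => (M i j).den_nz
  have hint : ∀ i j, ∃ c : ℤ, (c : ℚ) = m * M i j := by
    intro i j
    obtain ⟨c, hc⟩ : (M i j).den ∣ m :=
      (Finset.dvd_prod_of_mem (fun j => (M i j).den) (Finset.mem_univ j)).trans
        (Finset.dvd_prod_of_mem (fun i => ∏ j, (M i j).den) (Finset.mem_univ i))
    refine ⟨c * (M i j).num, ?_⟩
    rw [hc]
    push_cast
    rw [mul_comm ((M i j).den : ℚ), mul_assoc, Rat.den_mul_eq_num]
  refine ⟨m, hm, ?_⟩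
  rintro _ ⟨z, hz, rfl⟩
  rw [SetLike.mem_coe, mem_intLattice] at hz
  rw [mem_intLattice]
  choose w hw using hz
  choose c hc using hint
  intro i
  refine ⟨∑ j, c i j * w j, ?_⟩
  push_cast
  rw [mulHom_apply, Matrix.mulVec, dotProduct]
  refine Finset.sum_congr rfl fun j _ => ?_
  rw [hc, hw]
  simp

/-! ### Finite stages of `ℤⁿ[M]` and the inequality `a ≤ |det A| b` -/

/-- `ℤⁿ + M ℤⁿ + ⋯ + M ^ k ℤⁿ`. -/
def partLattice (M : Matrix (Fin n) (Fin n) ℚ) : ℕ → AddSubgroup (Fin n → ℚ)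
  | 0 => intLattice n
  | k + 1 => partLattice M k ⊔ (intLattice n).map (mulHom (M ^ (k + 1)))

section PartLattice

variable (M : Matrix (Fin n) (Fin n) ℚ)

theorem partLattice_mono : Monotone (partLattice M) :=
  monotone_nat_of_le_succ fun _ => le_sup_left

theorem intLattice_le_partLattice (k : ℕ) : intLattice n ≤ partLattice M k :=
  partLattice_mono M (Nat.zero_le k)

theorem partLattice_succ (k : ℕ) :
    partLattice M (k + 1) = intLattice n ⊔ (partLattice M k).map (mulHom M) := by
  induction k with
  | zero =>
    change intLattice n ⊔ (intLattice n).map (mulHom (M ^ 1)) =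
      intLattice n ⊔ (intLattice n).map (mulHom M)
    rw [pow_one]
  | succ k ih =>
    rw [partLattice, ih, sup_assoc, pow_succ' M (k + 1), mulHom_mul, ← AddSubgroup.map_map,
      ← AddSubgroup.map_sup, ← ih]
    rfl

theorem partLattice_le_polyLattice (k : ℕ) : partLattice M k ≤ polyLattice M := by
  induction k with
  | zero => exact intLattice_le_polyLattice M
  | succ k ih =>
    exact sup_le ih (le_iSup (fun k : ℕ => (intLattice n).map (mulHom (M ^ k))) (k + 1))

theorem polyLattice_eq_iSup : polyLattice M = ⨆ k, partLattice M k := by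
  refine le_antisymm (iSup_le fun k => ?_) (iSup_le (partLattice_le_polyLattice M))
  refine le_trans ?_ (le_iSup _ k)
  cases k with
  | zero => simp [mulHom_one, partLattice]
  | succ k => exact le_sup_right

theorem mem_polyLattice {x : Fin n → ℚ} : x ∈ polyLattice M ↔ ∃ k, x ∈ partLattice M k := by
  rw [polyLattice_eq_iSup]
  exact AddSubgroup.mem_iSup_of_directed (partLattice_mono M).directed_le

theorem polyLattice_eq_sup : polyLattice M = intLattice n ⊔ (polyLattice M).map (mulHom M) := by
  refine le_antisymm (fun x hx => ?_)
    (sup_le (intLattice_le_polyLattice M) (map_polyLattice_le M))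
  obtain ⟨k, hk⟩ := (mem_polyLattice M).1 hx
  have h := partLattice_mono M (Nat.le_succ k) hk
  rw [partLattice_succ] at h
  exact sup_le_sup_left (AddSubgroup.map_mono (partLattice_le_polyLattice M k)) _ h

/-- Since `ℤⁿ[M] = ℤⁿ + M ℤⁿ[M]`, the second isomorphism theorem moves the index into the finitely
generated group `ℤⁿ`. -/
theorem aIndex_eq_relIndex_intLattice :
    aIndex M = ((polyLattice M).map (mulHom M)).relIndex (intLattice n) :=
  calc aIndex M = ((polyLattice M).map (mulHom M)).relIndex
        (intLattice n ⊔ (polyLattice M).map (mulHom M)) := by rw [← polyLattice_eq_sup]; rfl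
    _ = _ := AddSubgroup.relIndex_sup_right _ _

/-- The chain of the lattices `ℤⁿ ∩ M (ℤⁿ + ⋯ + M ^ k ℤⁿ)` stabilizes. -/
theorem exists_inf_map_polyLattice_le :
    ∃ k, intLattice n ⊓ (polyLattice M).map (mulHom M) ≤ (partLattice M k).map (mulHom M) := by
  -- Pulled back along `f`, the chain becomes one of submodules of the noetherian `ℤ`-module `Fin n
  -- → ℤ`.
  let f : (Fin n → ℤ) →+ (Fin n → ℚ) := (Int.castAddHom ℚ).compLeft (Fin n)
  let c : ℕ →o Submodule ℤ (Fin n → ℤ) :=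
    ⟨fun k => (((partLattice M k).map (mulHom M)).comap f).toIntSubmodule, fun i j hij => by
      have := AddSubgroup.comap_mono (f := f)
        (AddSubgroup.map_mono (f := mulHom M) (partLattice_mono M hij))
      exact this⟩
  obtain ⟨k, hk⟩ := monotone_stabilizes_iff_noetherian.2
    (inferInstance : IsNoetherian ℤ (Fin n → ℤ)) c
  refine ⟨k, ?_⟩
  rintro x ⟨hx, y, hy, rfl⟩
  obtain ⟨j, hj⟩ := (mem_polyLattice M).1 hy
  choose w hw using mem_intLattice.1 hx
  have hfw : f w = mulHom M y := funext hw
  have hmem : w ∈ c (max k j) := by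
    change f w ∈ (partLattice M (max k j)).map (mulHom M)
    rw [hfw]
    exact ⟨y, partLattice_mono M (le_max_right _ _) hj, rfl⟩
  rw [← hk _ (le_max_left k j)] at hmem
  rw [← hfw]
  exact hmem

/-- `ℤⁿ[M]` need not be finitely generated, so determinants do not apply to it directly. At a stage
where the chain above has stabilized, its index is already seen between two lattices: both sides
equal the index in `ℤⁿ` of the same intersection. -/
theorem exists_relIndex_map_partLattice :
    ∃ k, ((partLattice M k).map (mulHom M)).relIndex (partLattice M (k + 1)) = aIndex M := by
  obtain ⟨k, hk⟩ := exists_inf_map_polyLattice_le M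
  refine ⟨k, ?_⟩
  rw [partLattice_succ, AddSubgroup.relIndex_sup_right, aIndex_eq_relIndex_intLattice,
    ← AddSubgroup.inf_relIndex_left (intLattice n),
    ← AddSubgroup.inf_relIndex_left (intLattice n) ((polyLattice M).map _)]
  congr 1
  exact le_antisymm (inf_le_inf_left _ (AddSubgroup.map_mono (partLattice_le_polyLattice M k)))
    (le_inf inf_le_left hk)

theorem exists_nsmul_partLattice_le (k : ℕ) :
    ∃ m : ℕ, m ≠ 0 ∧ ∀ x ∈ partLattice M k, m • x ∈ intLattice n := by
  induction k with
  | zero => exact ⟨1, one_ne_zero, fun x hx => by rwa [one_smul]⟩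
  | succ k ih =>
    obtain ⟨m, hm, h⟩ := ih
    obtain ⟨l, hl, h'⟩ := exists_nsmul_map_intLattice_le (M ^ (k + 1))
    refine ⟨m * l, mul_ne_zero hm hl, fun x hx => ?_⟩
    obtain ⟨y, hy, _, ⟨z, hz, rfl⟩, rfl⟩ := AddSubgroup.mem_sup.1 hx
    rw [smul_add]
    refine add_mem ?_ ?_
    · rw [mul_comm, mul_smul]
      exact nsmul_mem (h y hy) _
    · rw [mul_smul]
      refine nsmul_mem ?_ _
      have := h' ⟨z, hz, rfl⟩
      rwa [mulHom_apply, Matrix.smul_mulVec, Nat.cast_smul_eq_nsmul] at this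

theorem isUnit_det_natCast_smul_one {m : ℕ} (hm : m ≠ 0) :
    IsUnit ((m : ℚ) • (1 : Matrix (Fin n) (Fin n) ℚ)).det := by
  rw [isUnit_iff_ne_zero, Matrix.det_smul, Matrix.det_one, mul_one]
  exact pow_ne_zero _ (Nat.cast_ne_zero.2 hm)

theorem mulHom_natCast_smul_one (m : ℕ) (x : Fin n → ℚ) :
    mulHom ((m : ℚ) • (1 : Matrix (Fin n) (Fin n) ℚ)) x = m • x := by
  rw [mulHom_apply, Matrix.smul_mulVec, Matrix.one_mulVec, Nat.cast_smul_eq_nsmul]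

theorem relIndex_natCast_smul_intLattice {m : ℕ} (hm : m ≠ 0) :
    (((intLattice n).map (mulHom ((m : ℚ) • 1))).relIndex (intLattice n) : ℚ) = (m : ℚ) ^ n := by
  rw [relIndex_map_intLattice (isUnit_det_natCast_smul_one hm)]
  · simp
  · rintro _ ⟨z, hz, rfl⟩
    rw [mulHom_natCast_smul_one]
    exact nsmul_mem hz _

/-- A common denominator `m` carries the stage into `ℤⁿ` and `ℤⁿ` onto `m ℤⁿ`, which has finite
index `m ^ n` in `ℤⁿ`. -/
theorem relIndex_partLattice_ne_zero (k : ℕ) :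
    (intLattice n).relIndex (partLattice M k) ≠ 0 := by
  obtain ⟨m, hm, h⟩ := exists_nsmul_partLattice_le M k
  rw [← AddSubgroup.relIndex_map_map_of_injective _ _
    (mulHom_injective (isUnit_det_natCast_smul_one hm))]
  refine mt (AddSubgroup.relIndex_eq_zero_of_le_right ?_) (?_ :
    ((intLattice n).map (mulHom ((m : ℚ) • 1))).relIndex (intLattice n) ≠ 0)
  · rintro _ ⟨x, hx, rfl⟩
    rw [mulHom_natCast_smul_one]
    exact h x hx
  · rw [← Nat.cast_ne_zero (R := ℚ), relIndex_natCast_smul_intLattice hm]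
    exact pow_ne_zero _ (Nat.cast_ne_zero.2 hm)

/-- `M` multiplies covolumes by `|det M|`. In terms of indices: with `N_k` the `k`-th stage, compute
the index of `m M ℤⁿ` in `N_{k+1}` along the chain through `ℤⁿ ≤ N_k` and along the chain through `M
ℤⁿ ≤ M N_k`, and cancel `[N_k : ℤⁿ] = [M N_k : M ℤⁿ]` and `m ^ n`. The factor `m` is there because
`M ℤⁿ` need not lie in `ℤⁿ`. -/
theorem relIndex_partLattice_mul_det (hM : IsUnit M.det) (k : ℕ) :
    ((partLattice M k).relIndex (partLattice M (k + 1)) : ℚ) * |M.det| =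
      ((partLattice M k).map (mulHom M)).relIndex (partLattice M (k + 1)) := by
  obtain ⟨m, hm, hle⟩ := exists_nsmul_map_intLattice_le M
  have hm' : (m : ℚ) ^ n ≠ 0 := pow_ne_zero _ (Nat.cast_ne_zero.2 hm)
  let X := (intLattice n).map (mulHom ((m : ℚ) • M))
  have hX : X = ((intLattice n).map (mulHom ((m : ℚ) • 1))).map (mulHom M) := by
    rw [AddSubgroup.map_map, ← mulHom_mul, mul_smul_comm, mul_one]
  have hdet : ((m : ℚ) • M).det = (m : ℚ) ^ n * M.det := by simp
  have h1 : (X.relIndex (intLattice n) : ℚ) = (m : ℚ) ^ n * |M.det| := by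
    rw [relIndex_map_intLattice _ hle, hdet, abs_mul, abs_of_nonneg (by positivity)]
    rw [hdet]
    exact (isUnit_iff_ne_zero.2 hm').mul hM
  have h2 : (X.relIndex ((intLattice n).map (mulHom M)) : ℚ) = (m : ℚ) ^ n := by
    rw [hX, AddSubgroup.relIndex_map_map_of_injective _ _ (mulHom_injective hM),
      relIndex_natCast_smul_intLattice hm]
  have hXM : X ≤ (intLattice n).map (mulHom M) := by
    rw [hX]
    refine AddSubgroup.map_mono ?_
    rintro _ ⟨z, hz, rfl⟩
    rw [mulHom_natCast_smul_one]
    exact nsmul_mem hz _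
  have hMN : (intLattice n).map (mulHom M) ≤ (partLattice M k).map (mulHom M) :=
    AddSubgroup.map_mono (intLattice_le_partLattice M k)
  have hMN' : (partLattice M k).map (mulHom M) ≤ partLattice M (k + 1) := by
    rw [partLattice_succ]
    exact le_sup_right
  have e1 := AddSubgroup.relIndex_mul_relIndex _ _ _ (intLattice_le_partLattice M k)
    (partLattice_mono M (Nat.le_succ k))
  have e2 := AddSubgroup.relIndex_mul_relIndex _ _ _ hMN hMN'
  have e3 := AddSubgroup.relIndex_mul_relIndex _ _ _ hle (intLattice_le_partLattice M (k + 1))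
  have e4 := AddSubgroup.relIndex_mul_relIndex _ _ _ hXM (hMN.trans hMN')
  rw [AddSubgroup.relIndex_map_map_of_injective _ _ (mulHom_injective hM)] at e2
  have e5 := congrArg (Nat.cast (R := ℚ)) (e3.trans e4.symm)
  rw [← e1, ← e2, Nat.cast_mul, Nat.cast_mul, Nat.cast_mul, Nat.cast_mul, h1, h2] at e5
  have h0 : ((intLattice n).relIndex (partLattice M k) : ℚ) ≠ 0 :=
    Nat.cast_ne_zero.2 (relIndex_partLattice_ne_zero M k)
  refine mul_left_cancel₀ (mul_ne_zero hm' h0) ?_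
  linear_combination e5

/-- With `N_k` the stages for `A⁻¹`, multiplication by `A ^ (k + 1)` turns `[N_k + A ^ (-k-1) ℤⁿ :
N_k]` into the relative index of `A ^ (k + 1) N_k` in `ℤⁿ`. That group lies in `A ℤⁿ[A]`, whose
relative index in `ℤⁿ` is `a`. -/
theorem aIndex_le_relIndex_partLattice {A : Matrix (Fin n) (Fin n) ℚ} (hA : IsUnit A.det) (k : ℕ) :
    aIndex A ≤ (partLattice A⁻¹ k).relIndex (partLattice A⁻¹ (k + 1)) := by
  have hpow : ∀ j l : ℕ, A ^ (j + l) * A⁻¹ ^ l = A ^ j := fun j l => by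
    rw [pow_add, mul_assoc, Matrix.inv_pow', Matrix.mul_nonsing_inv _ (by
      rw [Matrix.det_pow]; exact hA.pow l), mul_one]
  have hpart : ∀ l j : ℕ, (partLattice A⁻¹ l).map (mulHom (A ^ (j + l))) ≤
      (polyLattice A).map (mulHom (A ^ j)) := by
    intro l
    induction l with
    | zero => exact fun j => AddSubgroup.map_mono (intLattice_le_polyLattice A)
    | succ l ih =>
      intro j
      have h : partLattice A⁻¹ (l + 1) =
        partLattice A⁻¹ l ⊔ (intLattice n).map (mulHom (A⁻¹ ^ (l + 1))) := rfl
      rw [h, AddSubgroup.map_sup]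
      refine sup_le ?_ ?_
      · rw [← add_assoc, add_right_comm]
        refine (ih (j + 1)).trans ?_
        rw [pow_succ, mulHom_mul, ← AddSubgroup.map_map]
        exact AddSubgroup.map_mono (map_polyLattice_le A)
      · rw [AddSubgroup.map_map, ← mulHom_mul, hpow]
        exact AddSubgroup.map_mono (intLattice_le_polyLattice A)
  have hinj : Function.Injective (mulHom (A ^ (k + 1))) :=
    mulHom_injective (by rw [Matrix.det_pow]; exact hA.pow _)
  -- An infinite index counts as `0`, so comparing indices requires the larger one to be finite.
  have hne : (partLattice A⁻¹ k).relIndex (partLattice A⁻¹ (k + 1)) ≠ 0 :=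
    mt (AddSubgroup.relIndex_eq_zero_of_le_left (intLattice_le_partLattice _ k))
      (relIndex_partLattice_ne_zero _ _)
  have h : partLattice A⁻¹ (k + 1) =
    partLattice A⁻¹ k ⊔ (intLattice n).map (mulHom (A⁻¹ ^ (k + 1))) := rfl
  rw [h, AddSubgroup.relIndex_sup_left,
    ← AddSubgroup.relIndex_map_map_of_injective _ _ hinj] at hne ⊢
  have hZ : ((intLattice n).map (mulHom (A⁻¹ ^ (k + 1)))).map (mulHom (A ^ (k + 1))) =
      intLattice n := by
    rw [AddSubgroup.map_map, ← mulHom_mul]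
    have := hpow 0 (k + 1)
    rw [zero_add, pow_zero] at this
    rw [this, mulHom_one, AddSubgroup.map_id]
  rw [hZ] at hne ⊢
  rw [aIndex_eq_relIndex_intLattice]
  refine AddSubgroup.relIndex_le_of_le_left ?_ hne
  have := hpart k 1
  rwa [add_comm 1 k, pow_one] at this

/-- `a ≤ |det A| b`. -/
theorem aIndex_le_det_mul_bIndex {A : Matrix (Fin n) (Fin n) ℚ} (hA : IsUnit A.det) :
    (aIndex A : ℚ) ≤ |A.det| * bIndex A := by
  -- At this stage `b = [N_{k+1} : A⁻¹ N_k] = [N_{k+1} : N_k] / |det A|`.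
  obtain ⟨k, hk⟩ := exists_relIndex_map_partLattice A⁻¹
  have h1 := relIndex_partLattice_mul_det A⁻¹ (Matrix.isUnit_nonsing_inv_det A hA) k
  have h2 : (aIndex A : ℚ) ≤ _ := Nat.cast_le.2 (aIndex_le_relIndex_partLattice hA k)
  refine h2.trans (le_of_eq ?_)
  rw [bIndex, ← hk, ← h1, mul_left_comm, ← abs_mul, ← Matrix.det_mul, Matrix.mul_nonsing_inv _ hA]
  simp

end PartLattice

/-! ### How `A` scales the Haar measure -/

section Scaling

theorem relIndex_bFil_one (A : Matrix (Fin n) (Fin n) ℚ) :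
    (bFil A 1).relIndex (bFil A 0) = bIndex A := by
  rw [bFil_zero, bFil, zpow_one]
  rfl

variable (A : Matrix (Fin n) (Fin n) ℚ) [hA : Fact (IsExpanding A)] [hb : Fact (2 ≤ bIndex A)]

instance : Countable (ZLaurent A) := inferInstanceAs (Countable (laurentLattice A))

instance : SecondCountableTopology (BSeries A) :=
  UniformSpace.secondCountable_of_separable _

instance : LocallyCompactSpace (BSeries A) :=
  (isCompact_unitBall A).locallyCompactSpace_of_mem_nhds_of_addGroup
    (Metric.closedBall_mem_nhds 0 one_pos)

instance : (muB A).IsAddHaarMeasure := Measure.isAddHaarMeasure_addHaarMeasure _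

instance : (mu A).IsAddHaarMeasure := Measure.prod.instIsAddHaarMeasure _ _

theorem norm_add_le_max_BSeries (x y : BSeries A) : ‖x + y‖ ≤ max ‖x‖ ‖y‖ := by
  induction x, y using UniformSpace.Completion.induction_on₂ with
  | hp => exact isClosed_le (by fun_prop) (by fun_prop)
  | ih x y =>
    rw [← UniformSpace.Completion.coe_add, UniformSpace.Completion.norm_coe,
      UniformSpace.Completion.norm_coe, UniformSpace.Completion.norm_coe]
    exact bNorm_add_le_max hA.out.isUnit_det hb.out x y

variable {A} in
theorem act_neg_act (k : ℤ) (p : KSpace A) : act A (-k) (act A k p) = p := by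
  rw [← act_add, neg_add_cancel, act_zero]

variable {A} in
theorem act_act_neg (k : ℤ) (p : KSpace A) : act A k (act A (-k) p) = p := by
  rw [← act_add, add_neg_cancel, act_zero]

/-- The action of `A ^ k` as an automorphism of the topological group `𝕂_A`. -/
def actEquiv (k : ℤ) : KSpace A ≃ₜ+ KSpace A where
  toFun := act A k
  invFun := act A (-k)
  left_inv := act_neg_act k
  right_inv := act_act_neg k
  map_add' := map_add _
  continuous_toFun := continuous_act A k
  continuous_invFun := continuous_act A (-k)

theorem powB_powB_neg (k : ℤ) (y : BSeries A) : powB A k (powB A (-k) y) = y :=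
  congrArg Prod.snd (act_act_neg (A := A) k (0, y))

/-- If `g_q` represents the `b` classes of `ℤⁿ[B] / B ℤⁿ[B]`, then by the ultrametric inequality the
unit balls around the points `A g_q` are disjoint and lie in the image of the unit ball. -/
theorem bIndex_le_muB_image :
    (bIndex A : ENNReal) * muB A (Metric.closedBall 0 1) ≤
      muB A (powB A 1 '' Metric.closedBall 0 1) := by
  have hd := hA.out.isUnit_det
  have hb0 : (0 : ℝ) < bIndex A := by
    have := hb.out
    positivity
  let Q := bFil A 0 ⧸ (bFil A 1).addSubgroupOf (bFil A 0)
  have hcard : Nat.card Q = bIndex A := relIndex_bFil_one A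
  have : Finite Q := Nat.finite_of_card_ne_zero (by have := hb.out; omega)
  have : Fintype Q := Fintype.ofFinite Q
  have hle : ∀ q : bFil A 0, (q : Fin n → ℚ) ∈ laurentLattice A := fun q =>
    polyLattice_inv_le A hd (bFil_zero A ▸ q.2)
  let g : Q → ZLaurent A := fun q => ⟨(q.out : bFil A 0), hle _⟩
  have hg1 : ∀ q, ‖g q‖ ≤ 1 := fun q => (norm_le_one_iff A).2 q.out.2
  -- `A` multiplies the norm by `b`, so the hypothesis says that `g q - g q'` has norm at most
  -- `b⁻¹`, that is, lies in `B ℤⁿ[B]`.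
  have hinj : ∀ q q', ‖powZ A 1 (g q - g q')‖ ≤ 1 → q = q' := by
    intro q q' h
    rw [norm_powZ, zpow_one, ← le_div_iff₀' hb0, norm_def, one_div, ← zpow_neg_one,
      bNorm_le_iff hd hb.out] at h
    rw [← QuotientAddGroup.out_eq' q, ← QuotientAddGroup.out_eq' q', eq_comm,
      QuotientAddGroup.eq, AddSubgroup.mem_addSubgroupOf, neg_add_eq_sub]
    exact h
  let x : Q → BSeries A := fun q => powB A 1 (g q : BSeries A)
  have hsub : ∀ q, Metric.closedBall (x q) 1 ⊆ powB A 1 '' Metric.closedBall 0 1 := by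
    intro q y hy
    refine ⟨powB A (-1) y, ?_, powB_powB_neg A 1 y⟩
    have hy' : y = powB A 1 (g q : BSeries A) + (y - x q) := (add_sub_cancel _ _).symm
    have h1 : powB A (-1) (x q) = (g q : BSeries A) := by
      have := powB_powB_neg A (-1) (g q : BSeries A)
      rwa [neg_neg] at this
    rw [mem_closedBall_zero_iff, hy', map_add]
    refine (norm_add_le_max_BSeries A _ _).trans (max_le ?_ ?_)
    · change ‖powB A (-1) (x q)‖ ≤ 1
      rw [h1, UniformSpace.Completion.norm_coe]
      exact hg1 q
    · rw [norm_powB]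
      rw [mem_closedBall_iff_norm] at hy
      refine mul_le_one₀ ?_ (norm_nonneg _) hy
      refine zpow_le_one_of_nonpos₀ ?_ (by norm_num)
      exact_mod_cast le_trans one_le_two hb.out
  have hdisj : Pairwise (Function.onFun Disjoint fun q => Metric.closedBall (x q) 1) := by
    intro q q' hne
    refine Set.disjoint_left.2 fun y hy hy' => hne (hinj q q' ?_)
    rw [mem_closedBall_iff_norm'] at hy
    rw [mem_closedBall_iff_norm] at hy'
    rw [← UniformSpace.Completion.norm_coe, ← powB_coe, UniformSpace.Completion.coe_sub, map_sub]
    have : powB A 1 (g q : BSeries A) - powB A 1 (g q' : BSeries A) = (x q - y) + (y - x q') := by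
      rw [sub_add_sub_cancel]
    rw [this]
    exact (norm_add_le_max_BSeries A _ _).trans (max_le hy hy')
  have hmeas : ∀ q, muB A (Metric.closedBall (x q) 1) = muB A (Metric.closedBall 0 1) := by
    intro q
    rw [← measure_preimage_add (muB A) (x q) (Metric.closedBall (x q) 1)]
    congr 1
    ext y
    simp
  calc (bIndex A : ENNReal) * muB A (Metric.closedBall 0 1)
      = ∑ q : Q, muB A (Metric.closedBall (x q) 1) := by
        simp [hmeas, ← hcard, Nat.card_eq_fintype_card]
    _ = muB A (⋃ q, Metric.closedBall (x q) 1) := by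
        rw [measure_iUnion hdisj fun q => Metric.isClosed_closedBall.measurableSet, tsum_fintype]
    _ ≤ _ := measure_mono (Set.iUnion_subset hsub)

/-- Multiplication by `A` scales the Haar measure by at least `a`. -/
theorem aIndex_mul_le_mu_image (E : Set (KSpace A)) :
    (aIndex A : ENNReal) * mu A E ≤ mu A (act A 1 '' E) := by
  -- As an automorphism of the group, `A` scales every set by the same factor `c`, so it suffices to
  -- test the product `V ×ˢ W` of the unit balls.
  set c := addEquivAddHaarChar (actEquiv A 1)
  have hc : ∀ E : Set (KSpace A), mu A (act A 1 '' E) = c * mu A E := by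
    intro E
    have := addEquivAddHaarChar_smul_preimage (mu A) (X := act A 1 '' E) (actEquiv A 1)
    rw [← this]
    change _ = _ * _
    congr 2
    exact Set.preimage_image_eq E (actEquiv A 1).injective
  rw [hc]
  gcongr
  let V : Set (EuclideanSpace ℝ (Fin n)) := Metric.closedBall 0 1
  let W : Set (BSeries A) := Metric.closedBall 0 1
  let f := Matrix.toEuclideanLin ((A ^ (1 : ℤ)).map (algebraMap ℚ ℝ))
  have hV0 : volume V ≠ 0 := (Metric.measure_closedBall_pos _ _ one_pos).ne'
  have hVt : volume V ≠ ⊤ := (isCompact_closedBall _ _).measure_lt_top.ne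
  have hW : muB A W = 1 := Measure.addHaarMeasure_self
  have himage : act A 1 '' (V ×ˢ W) = (f '' V) ×ˢ (powB A 1 '' W) :=
    Set.prodMap_image_prod f (powB A 1) V W
  have hdet : LinearMap.det f = ((A.det : ℚ) : ℝ) := by
    change LinearMap.det (Matrix.toEuclideanLin ((A ^ (1 : ℤ)).map (algebraMap ℚ ℝ))) = _
    rw [zpow_one, LinearMap.det_toLpLin]
    exact (RingHom.map_det (algebraMap ℚ ℝ) A).symm
  have h1 : c * volume V = ENNReal.ofReal |LinearMap.det f| * volume V * muB A (powB A 1 '' W) := by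
    rw [← Measure.addHaar_image_linearMap, ← Measure.prod_prod, ← himage]
    change _ = mu A _
    rw [hc, mu, Measure.prod_prod, hW, mul_one]
  have h2 : (bIndex A : ENNReal) ≤ muB A (powB A 1 '' W) := by
    simpa [W, hW] using bIndex_le_muB_image A
  have h3 : (aIndex A : ENNReal) ≤ ENNReal.ofReal |LinearMap.det f| * bIndex A := by
    have := aIndex_le_det_mul_bIndex hA.out.isUnit_det
    have h : (aIndex A : ℝ) ≤ |LinearMap.det f| * bIndex A := by
      rw [hdet]
      exact_mod_cast this
    have := ENNReal.ofReal_le_ofReal h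
    rwa [ENNReal.ofReal_mul (abs_nonneg _), ENNReal.ofReal_natCast, ENNReal.ofReal_natCast] at this
  refine h3.trans ?_
  rw [← ENNReal.mul_le_mul_iff_left hV0 hVt, h1, mul_right_comm]
  gcongr

end Scaling

/-! ### A counting criterion for null overlaps -/

/-- If finitely many, at most `N`, sets of equal finite measure `v` have a union of measure at
least `N v`, then they are pairwise disjoint up to null sets. -/
theorem measure_inter_eq_zero_of_mul_le {α ι : Type*} [MeasurableSpace α] {μ : Measure α}
    {s : Set ι} (hs : s.Finite) {N : ℕ} (hN : s.ncard ≤ N) {E : ι → Set α} {v : ENNReal}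
    (hv : v ≠ ⊤) (hE : ∀ i, μ (E i) = v) (hm : ∀ i, MeasurableSet (E i))
    (hU : N * v ≤ μ (⋃ i ∈ s, E i)) {i j : ι} (hi : i ∈ s) (hj : j ∈ s) (hij : i ≠ j) :
    μ (E i ∩ E j) = 0 := by
  classical
  lift s to Finset ι using hs
  rw [Set.ncard_coe_finset] at hN
  have hj' : j ∈ s.erase i := Finset.mem_erase.2 ⟨hij.symm, hj⟩
  let t := (s.erase i).erase j
  have ht : t.card + 2 = s.card := by
    have h1 := Finset.card_erase_add_one hj'
    have h2 := Finset.card_erase_add_one (Finset.mem_coe.1 hi)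
    rw [← h2, ← h1]
  have hsub : (⋃ k ∈ (s : Set ι), E k) ⊆ (E i ∪ E j) ∪ ⋃ k ∈ t, E k := by
    refine Set.iUnion₂_subset fun k hk => ?_
    by_cases hki : k = i
    · exact hki ▸ Set.subset_union_left.trans Set.subset_union_left
    by_cases hkj : k = j
    · exact hkj ▸ Set.subset_union_right.trans Set.subset_union_left
    · refine Set.Subset.trans ?_ Set.subset_union_right
      exact Set.subset_biUnion_of_mem (u := E)
        (Finset.mem_erase.2 ⟨hkj, Finset.mem_erase.2 ⟨hki, hk⟩⟩ : k ∈ t)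
  have hrest : μ (⋃ k ∈ t, E k) ≤ t.card * v :=
    (measure_biUnion_finset_le t E).trans (by simp [hE])
  -- `E i ∪ E j` and the other `|s| - 2` sets must fill measure `N v ≥ |s| v`, but `E i` and `E j`
  -- contribute only `2 v - μ (E i ∩ E j)`.
  have key : s.card * v + μ (E i ∩ E j) ≤ s.card * v + 0 :=
    calc s.card * v + μ (E i ∩ E j) ≤ N * v + μ (E i ∩ E j) := by gcongr
      _ ≤ (μ (E i ∪ E j) + t.card * v) + μ (E i ∩ E j) := by
        gcongr
        exact hU.trans ((measure_mono hsub).trans ((measure_union_le _ _).trans (by gcongr)))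
      _ = (μ (E i ∪ E j) + μ (E i ∩ E j)) + t.card * v := add_right_comm _ _ _
      _ = s.card * v + 0 := by
        rw [measure_union_add_inter _ (hm j), hE, hE, ← ht]
        push_cast
        ring
  exact nonpos_iff_eq_zero.1 ((ENNReal.add_le_add_iff_left
    (ENNReal.mul_ne_top (ENNReal.natCast_ne_top _) hv)).1 key)

/-! ### Digit blocks `D_k` -/

section Blocks

variable {A : Matrix (Fin n) (Fin n) ℚ}

/-- The sum is split after its `j` lowest digits. -/
theorem blocks_add (D : Finset (Fin n → ℚ)) (j k : ℕ) :
    blocks A D (j + k) = blocks A D j + (mulHom (A ^ j)) '' blocks A D k := by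
  ext x
  simp only [Set.mem_add, blocks, Set.mem_ofPred_eq, Set.mem_image]
  constructor
  · rintro ⟨d, hd, rfl⟩
    refine ⟨_, ⟨fun i => d (Fin.castAdd k i), fun i => hd _, rfl⟩, _,
      ⟨_, ⟨fun i => d (Fin.natAdd j i), fun i => hd _, rfl⟩, rfl⟩, ?_⟩
    rw [Fin.sum_univ_add, map_sum]
    congr 1
    refine Finset.sum_congr rfl fun i _ => ?_
    rw [Fin.val_natAdd, pow_add, mulHom_mul]
    rfl
  · rintro ⟨_, ⟨d, hd, rfl⟩, _, ⟨_, ⟨d', hd', rfl⟩, rfl⟩, rfl⟩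
    refine ⟨Fin.append d d', fun i => ?_, ?_⟩
    · induction i using Fin.addCases with
      | left i => simpa using hd i
      | right i => simpa using hd' i
    · rw [Fin.sum_univ_add, map_sum]
      congr 1
      · simp
      · refine Finset.sum_congr rfl fun i _ => ?_
        rw [Fin.append_right, Fin.val_natAdd, pow_add, mulHom_mul]
        rfl

theorem blocks_zero (D : Finset (Fin n → ℚ)) : blocks A D 0 = {0} := by
  ext x
  simp [blocks]

theorem blocks_one (D : Finset (Fin n → ℚ)) : blocks A D 1 = D := by
  ext x
  simp only [blocks, Set.mem_ofPred_eq, Finset.mem_coe]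
  constructor
  · rintro ⟨d, hd, rfl⟩
    simpa [mulHom_one] using hd 0
  · intro hx
    exact ⟨fun _ => x, fun _ => hx, by simp [mulHom_one]⟩

theorem blocks_eq_range_sum (D : Finset (Fin n → ℚ)) (k : ℕ) :
    blocks A D k = Set.range fun d : Fin k → D =>
      ∑ i : Fin k, mulHom (A ^ (i : ℕ)) (d i : Fin n → ℚ) := by
  ext x
  constructor
  · rintro ⟨d, hd, rfl⟩
    exact ⟨fun i => ⟨d i, hd i⟩, rfl⟩
  · rintro ⟨d, rfl⟩
    exact ⟨fun i => d i, fun i => (d i).2, rfl⟩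

theorem blocks_finite (D : Finset (Fin n → ℚ)) (k : ℕ) : (blocks A D k).Finite := by
  rw [blocks_eq_range_sum]
  exact Set.finite_range _

/-- Different digit strings may have the same sum; the upper bound is all that the counting argument
needs. -/
theorem ncard_blocks_le (D : Finset (Fin n → ℚ)) (k : ℕ) :
    (blocks A D k).ncard ≤ D.card ^ k := by
  rw [blocks_eq_range_sum, ← Set.image_univ]
  refine (Set.ncard_image_le Set.finite_univ).trans (le_of_eq ?_)
  simp [Set.ncard_univ]

theorem blocks_subset_laurentLattice {A : Matrix (Fin n) (Fin n) ℚ} (hA : IsUnit A.det)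
    {D : Finset (Fin n → ℚ)} (hD : IsDigitSet A D) (k : ℕ) : blocks A D k ⊆ laurentLattice A := by
  rintro _ ⟨d, hd, rfl⟩
  refine sum_mem fun i _ => ?_
  rw [← zpow_natCast]
  exact zpow_mem_laurentLattice hA _
    (polyLattice_le A (hD.mem_polyLattice _ (hd i)))

theorem exists_val_eq (hA : IsUnit A.det) {D : Finset (Fin n → ℚ)} (hD : IsDigitSet A D) {k : ℕ}
    {x : Fin n → ℚ}
    (hx : x ∈ blocks A D k) : ∃ y : ZLaurent A, y.val = x :=
  ⟨⟨x, blocks_subset_laurentLattice hA hD k hx⟩, rfl⟩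

theorem ZLaurent.val_injective : Function.Injective (ZLaurent.val (A := A)) :=
  Subtype.val_injective

end Blocks

/-! ### Iterated set equation and null overlaps -/

section Tile

variable {A : Matrix (Fin n) (Fin n) ℚ} [hA : Fact (IsExpanding A)] [hb : Fact (2 ≤ bIndex A)]

theorem mem_translate {F : Set (KSpace A)} {s p : KSpace A} : p ∈ translate F s ↔ p - s ∈ F := by
  constructor
  · rintro ⟨f, hf, rfl⟩
    simpa using hf
  · exact fun h => ⟨p - s, h, sub_add_cancel _ _⟩

theorem translate_inter_translate_add (F : Set (KSpace A)) (p q t : KSpace A) :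
    translate F (p + t) ∩ translate F (q + t) = translate (translate F p ∩ translate F q) t := by
  ext y
  simp only [Set.mem_inter_iff, mem_translate, sub_sub, add_comm t]

theorem mu_translate (F : Set (KSpace A)) (s : KSpace A) : mu A (translate F s) = mu A F := by
  rw [← measure_preimage_add_right (mu A) s (translate F s)]
  congr 1
  ext p
  simp [mem_translate]

theorem act_image_translate (k : ℤ) (F : Set (KSpace A)) (s : KSpace A) :
    act A k '' translate F s = translate (act A k '' F) (act A k s) := by
  rw [translate, translate, Set.image_image, Set.image_image]
  simp only [map_add]

theorem act_act (j k : ℕ) (p : KSpace A) :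
    act A (j : ℤ) (act A (k : ℤ) p) = act A ((j + k : ℕ) : ℤ) p := by
  rw [Nat.cast_add, act_add]

theorem phi_add (x y : ZLaurent A) : phi A (x + y) = phi A x + phi A y := by
  refine Prod.ext ?_ (UniformSpace.Completion.coe_add x y)
  ext i
  simp [phi]

theorem phi_sub (x y : ZLaurent A) : phi A (x - y) = phi A x - phi A y := by
  rw [eq_sub_iff_add_eq, ← phi_add, sub_add_cancel]

theorem act_phi (k : ℤ) (x : ZLaurent A) : act A k (phi A x) = phi A (powZ A k x) := by
  refine Prod.ext ?_ (powB_coe A k x)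
  ext i
  simp [phi, act, val_powZ, mulHom_apply, Matrix.mulVec, dotProduct, Matrix.toLpLin_apply]

variable (A) in
/-- The set `φ(D_k)`. -/
def blockSet (D : Finset (Fin n → ℚ)) (k : ℕ) : Set (KSpace A) := phiImage A (blocks A D k)

theorem zero_mem_blockSet_zero (D : Finset (Fin n → ℚ)) : (0 : KSpace A) ∈ blockSet A D 0 := by
  refine ⟨0, ?_, ?_⟩
  · simp [blocks_zero]
  · simpa using phi_sub (A := A) 0 0

theorem blockSet_finite (D : Finset (Fin n → ℚ)) (k : ℕ) : (blockSet A D k).Finite :=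
  ((blocks_finite D k).preimage ZLaurent.val_injective.injOn).image _

theorem ncard_blockSet_le {D : Finset (Fin n → ℚ)} (hD : IsDigitSet A D) (k : ℕ) :
    (blockSet A D k).ncard ≤ aIndex A ^ k := by
  rw [← hD.card_eq]
  refine le_trans ?_ (ncard_blocks_le (A := A) D k)
  have hfin := (blocks_finite (A := A) D k).preimage (ZLaurent.val_injective (A := A)).injOn
  refine (Set.ncard_image_le hfin).trans ?_
  rw [← Set.ncard_image_of_injective _ ZLaurent.val_injective]
  exact Set.ncard_le_ncard (Set.image_preimage_subset _ _) (blocks_finite D k)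

theorem blockSet_add {D : Finset (Fin n → ℚ)} (hD : IsDigitSet A D) (j k : ℕ) :
    blockSet A D (j + k) = blockSet A D j + act A (j : ℤ) '' blockSet A D k := by
  ext p
  constructor
  · rintro ⟨x, hx, rfl⟩
    rw [Set.mem_ofPred_eq, blocks_add] at hx
    obtain ⟨y, hy, _, ⟨z, hz, rfl⟩, hyz⟩ := hx
    obtain ⟨y, rfl⟩ := exists_val_eq hA.out.isUnit_det hD hy
    obtain ⟨z, rfl⟩ := exists_val_eq hA.out.isUnit_det hD hz
    refine ⟨phi A y, ⟨y, hy, rfl⟩, _, ⟨phi A z, ⟨z, hz, rfl⟩, rfl⟩, ?_⟩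
    rw [act_phi]
    refine (phi_add _ _).symm.trans (congrArg (phi A) (ZLaurent.val_injective ?_))
    rw [← hyz, map_add, val_powZ, zpow_natCast]
  · rintro ⟨_, ⟨y, hy, rfl⟩, _, ⟨_, ⟨z, hz, rfl⟩, rfl⟩, rfl⟩
    refine ⟨y + powZ A j z, ?_, ?_⟩
    · rw [Set.mem_ofPred_eq, blocks_add]
      refine ⟨_, hy, _, ⟨_, hz, rfl⟩, ?_⟩
      rw [map_add, val_powZ, zpow_natCast]
    · rw [act_phi]
      exact phi_add _ _

/-- `phiImage` sees only vectors of `ℤⁿ(B)`; as the blocks lie there, `φ` can be applied before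
subtracting. -/
theorem mem_delta {D : Finset (Fin n → ℚ)} (hD : IsDigitSet A D) {s : KSpace A} :
    s ∈ delta A D ↔ ∃ k, 1 ≤ k ∧ ∃ p ∈ blockSet A D k, ∃ q ∈ blockSet A D k, s = p - q := by
  simp only [delta, Set.mem_iUnion, exists_prop]
  refine exists_congr fun k => and_congr_right fun _ => ?_
  constructor
  · rintro ⟨x, ⟨y, hy, z, hz, hyz⟩, rfl⟩
    obtain ⟨y, rfl⟩ := exists_val_eq hA.out.isUnit_det hD hy
    obtain ⟨z, rfl⟩ := exists_val_eq hA.out.isUnit_det hD hz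
    refine ⟨_, ⟨y, hy, rfl⟩, _, ⟨z, hz, rfl⟩, ?_⟩
    rw [← phi_sub]
    exact congrArg (phi A) (ZLaurent.val_injective ((map_sub _ _ _).trans hyz).symm)
  · rintro ⟨_, ⟨y, hy, rfl⟩, _, ⟨z, hz, rfl⟩, rfl⟩
    exact ⟨y - z, ⟨_, hy, _, hz, (map_sub _ _ _).symm⟩, phi_sub _ _⟩

/-- `A ^ k F = ⋃_{d ∈ D_k} (F + φ(d))`. -/
theorem act_image_tile {D : Finset (Fin n → ℚ)} (hD : IsDigitSet A D) (k : ℕ) :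
    act A (k : ℤ) '' tile hD = ⋃ p ∈ blockSet A D k, translate (tile hD) p := by
  induction k with
  | zero =>
    have h0 : blockSet A D 0 = {0} := by
      refine Set.eq_singleton_iff_unique_mem.2 ⟨zero_mem_blockSet_zero D, ?_⟩
      rintro _ ⟨x, hx, rfl⟩
      rw [Set.mem_ofPred_eq, blocks_zero, Set.mem_singleton_iff] at hx
      have : x = 0 := ZLaurent.val_injective hx
      rw [this]
      simpa using phi_sub (A := A) 0 0
    rw [h0, Set.biUnion_singleton, Nat.cast_zero]
    ext p
    simp [mem_translate, act_zero]
  | succ k ih =>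
    have h1 : blockSet A D 1 = phiImage A D := by rw [blockSet, blocks_one]
    have h2 : act A ((k + 1 : ℕ) : ℤ) '' tile hD = act A (1 : ℤ) '' (act A (k : ℤ) '' tile hD) := by
      rw [Set.image_image]
      refine Set.image_congr fun p _ => ?_
      rw [← act_add]
      congr 2
      push_cast
      ring
    -- Applying `A` once more shifts the existing `k` digits up and creates a new lowest digit,
    -- hence the splitting `1 + k`.
    rw [h2, ih, Set.image_iUnion₂, add_comm k 1, blockSet_add hD]
    have h3 := (tile_spec hD).2.2
    rw [← h1] at h3
    ext p
    simp only [act_image_translate, h3, Set.mem_iUnion, exists_prop, mem_translate]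
    constructor
    · rintro ⟨q, hq, e, he, h⟩
      refine ⟨e + act A 1 q, ⟨e, he, _, ⟨q, hq, rfl⟩, rfl⟩, ?_⟩
      rwa [add_comm, ← sub_sub]
    · rintro ⟨_, ⟨e, he, _, ⟨q, hq, rfl⟩, rfl⟩, h⟩
      refine ⟨q, hq, e, he, ?_⟩
      rw [sub_sub, add_comm]
      exact h

theorem isCompact_tile {D : Finset (Fin n → ℚ)} (hD : IsDigitSet A D) : IsCompact (tile hD) :=
  (tile_spec hD).2.1

theorem pow_aIndex_mul_le (k : ℕ) (E : Set (KSpace A)) :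
    (aIndex A : ENNReal) ^ k * mu A E ≤ mu A (act A (k : ℤ) '' E) := by
  induction k with
  | zero =>
    rw [pow_zero, one_mul, Nat.cast_zero]
    refine measure_mono fun p hp => ⟨p, hp, act_zero A p⟩
  | succ k ih =>
    have h2 : act A ((k + 1 : ℕ) : ℤ) '' E = act A (1 : ℤ) '' (act A (k : ℤ) '' E) := by
      rw [Set.image_image]
      refine Set.image_congr fun p _ => ?_
      rw [← act_add]
      congr 2
      push_cast
      ring
    rw [h2, pow_succ', mul_assoc]
    exact le_trans (by gcongr) (aIndex_mul_le_mu_image A _)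

/-- Distinct translates of `F` by points of `φ(D_k)` have a null intersection. -/
theorem mu_inter_eq_zero {D : Finset (Fin n → ℚ)} (hD : IsDigitSet A D) {k : ℕ} {p q : KSpace A}
    (hp : p ∈ blockSet A D k) (hq : q ∈ blockSet A D k) (hpq : p ≠ q) :
    mu A (translate (tile hD) p ∩ translate (tile hD) q) = 0 := by
  refine measure_inter_eq_zero_of_mul_le (E := translate (tile hD)) (blockSet_finite D k)
    (ncard_blockSet_le hD k) (isCompact_tile hD).measure_lt_top.ne (mu_translate (tile hD))
    (fun s => ((isCompact_tile hD).image (continuous_add_const s)).isClosed.measurableSet)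
    ?_ hp hq hpq
  -- The union of the translates is `A ^ k F`, of measure at least `a ^ k μ(F)`, and there are at
  -- most `a ^ k` of them.
  rw [← act_image_tile, Nat.cast_pow]
  exact pow_aIndex_mul_le k _

end Tile

/-! ### Expansion, and a periodic interior point -/

section Main

variable {A : Matrix (Fin n) (Fin n) ℚ} [hA : Fact (IsExpanding A)] [hb : Fact (2 ≤ bIndex A)]

variable (A) in
/-- Eventually, `A ^ (-k)` contracts `𝕂_A` by any given factor. -/
theorem eventually_norm_act_neg_le {ε : ℝ} (hε : 0 < ε) :
    ∀ᶠ k : ℕ in atTop, ∀ p : KSpace A, ‖act A (-(k : ℤ)) p‖ ≤ ε * ‖p‖ := by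
  obtain ⟨C, r, hC0, hr0, hr1, hC⟩ := exists_bound A
  have h0 : Tendsto (fun k : ℕ => C * r ^ k) atTop (𝓝 0) := by
    simpa using (tendsto_pow_atTop_nhds_zero_of_lt_one hr0 hr1).const_mul C
  filter_upwards [h0.eventually_lt_const hε] with k hk p
  exact (hC k p).trans (mul_le_mul_of_nonneg_right hk.le (norm_nonneg _))

theorem iterate_act (k m : ℕ) (p : KSpace A) :
    (act A (k : ℤ))^[m] p = act A ((k * m : ℕ) : ℤ) p := by
  induction m with
  | zero => simp [act_zero]
  | succ m ih => rw [Function.iterate_succ_apply', ih, act_act, Nat.mul_succ, add_comm]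

theorem isExpandingLinear_act {k : ℕ} (hk : 1 ≤ k) : IsExpandingLinear (act A (k : ℤ)) where
  continuous := continuous_act A k
  bijective := (actEquiv A k).bijective
  commutes p := by rw [← act_add, ← act_add, add_comm]
  expands := by
    obtain ⟨C, r, hC0, hr0, hr1, hC⟩ := exists_bound A
    -- The contraction rate `r` and the constant `C` may vanish; `r'` and `C + 1` are positive and
    -- can be inverted.
    let r' := max r (1 / 2)
    have hr'0 : 0 < r' := lt_max_of_lt_right (by norm_num)
    have hr'1 : r' < 1 := max_lt hr1 (by norm_num)
    refine ⟨(C + 1)⁻¹, r'⁻¹, by positivity, (one_lt_inv₀ hr'0).2 hr'1, fun m p q => ?_⟩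
    rw [iterate_act, iterate_act, dist_eq_norm, dist_eq_norm, ← map_sub, inv_pow]
    have h1 := hC (k * m) (act A ((k * m : ℕ) : ℤ) (p - q))
    rw [act_neg_act] at h1
    rw [mul_assoc, inv_mul_le_iff₀ (by positivity), inv_mul_le_iff₀ (by positivity)]
    refine h1.trans ?_
    have h2 : r ^ (k * m) ≤ r' ^ m :=
      calc r ^ (k * m) ≤ r' ^ (k * m) := pow_le_pow_left₀ hr0 (le_max_left _ _) _
        _ ≤ r' ^ m := pow_le_pow_of_le_one hr'0.le hr'1.le (Nat.le_mul_of_pos_left m hk)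
    rw [← mul_assoc, mul_comm (r' ^ m)]
    gcongr
    linarith

variable {D : Finset (Fin n → ℚ)}

/-- Every point of `F` lies in small pieces `A ^ (-k) (F + φ(d))`, `d ∈ D_k`, of `F`. -/
theorem eventually_exists_piece (hD : IsDigitSet A D) {p : KSpace A} (hp : p ∈ tile hD) {ε : ℝ}
    (hε : 0 < ε) :
    ∀ᶠ k : ℕ in atTop, ∃ d ∈ blockSet A D k, ∀ f ∈ tile hD,
      act A (-(k : ℤ)) (f + d) ∈ tile hD ∩ Metric.ball p ε := by
  obtain ⟨R, hR⟩ := (isCompact_tile hD).isBounded.exists_norm_le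
  have hR0 : 0 ≤ R := (norm_nonneg _).trans (hR p hp)
  -- `2 * R + 1` exceeds every distance between points of `F`, so the piece containing `p` lies
  -- within `ε` of it.
  filter_upwards [eventually_norm_act_neg_le A
    (show 0 < ε / (2 * R + 1) by positivity)] with k hk
  have hmem : act A (k : ℤ) p ∈ ⋃ d ∈ blockSet A D k, translate (tile hD) d :=
    act_image_tile hD k ▸ ⟨p, hp, rfl⟩
  simp only [Set.mem_iUnion, exists_prop] at hmem
  obtain ⟨d, hd, g, hg, hgp⟩ := hmem
  refine ⟨d, hd, fun f hf => ⟨?_, ?_⟩⟩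
  · have h : f + d ∈ act A (k : ℤ) '' tile hD := by
      rw [act_image_tile]
      exact Set.mem_biUnion hd ⟨f, hf, rfl⟩
    obtain ⟨q, hq, hqf⟩ := h
    rwa [← hqf, act_neg_act]
  · have h : act A (-(k : ℤ)) (f + d) - p = act A (-(k : ℤ)) (f - g) := by
      nth_rewrite 1 [← act_neg_act (k : ℤ) p]
      rw [← hgp, ← map_sub, add_sub_add_right_eq_sub]
    rw [Metric.mem_ball, dist_eq_norm, h]
    refine (hk _).trans_lt ?_
    have h2 : ‖f - g‖ < 2 * R + 1 := by
      have := norm_sub_le f g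
      linarith [hR f hf, hR g hg]
    calc ε / (2 * R + 1) * ‖f - g‖ < ε / (2 * R + 1) * (2 * R + 1) := by gcongr
      _ = ε := div_mul_cancel₀ _ (by positivity)

/-- The ball contains a whole small piece of `F`, and with it a shrunken copy of the open set `U`.
-/
theorem mu_tile_inter_ball_pos (hD : IsDigitSet A D) (hF : ∃ U ⊆ tile hD, IsOpen U ∧ U.Nonempty)
    {p : KSpace A}
    (hp : p ∈ tile hD) {ε : ℝ} (hε : 0 < ε) : mu A (tile hD ∩ Metric.ball p ε) ≠ 0 := by
  obtain ⟨U, hUF, hU, u, hu⟩ := hF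
  obtain ⟨k, d, -, hd⟩ := (eventually_exists_piece hD hp hε).exists
  have hopen : IsOpen {q : KSpace A | act A (k : ℤ) q - d ∈ U} :=
    hU.preimage ((continuous_act A k).sub continuous_const)
  have hne : {q : KSpace A | act A (k : ℤ) q - d ∈ U}.Nonempty := by
    refine ⟨act A (-(k : ℤ)) (u + d), ?_⟩
    change act A (k : ℤ) (act A (-(k : ℤ)) (u + d)) - d ∈ U
    rwa [act_act_neg, add_sub_cancel_right]
  refine ((hopen.measure_pos (mu A) hne).trans_le (measure_mono fun q hq => ?_)).ne'
  have := hd _ (hUF hq)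
  rwa [sub_add_cancel, act_neg_act] at this

/-- If `F` has an interior point, then it has one, `x`, with `A ^ k x = x + φ(d)` for some `k ≥ 1`
and `d ∈ D_k`. -/
theorem exists_periodic_interior (hD : IsDigitSet A D) (hF : ∃ U ⊆ tile hD, IsOpen U ∧ U.Nonempty) :
    ∃ k : ℕ, 1 ≤ k ∧ ∃ d ∈ blockSet A D k, ∃ x : KSpace A, act A (k : ℤ) x = x + d ∧
      ∃ δ > 0, Metric.ball x δ ⊆ tile hD := by
  obtain ⟨U, hUF, hU, u, hu⟩ := hF
  obtain ⟨ε, hε, hεU⟩ := Metric.isOpen_iff.1 hU u hu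
  obtain ⟨k, ⟨⟨d, hdk, hd⟩, hk⟩, hk1⟩ := (((eventually_exists_piece hD (hUF hu) hε).and
    (eventually_norm_act_neg_le A (show (0 : ℝ) < (1 / 2 : NNReal) by norm_num))).and
      (eventually_ge_atTop 1)).exists
  -- `g` maps `F` into a ball inside `U`, so its fixed point is interior to `F`; `g x = x` reads `A
  -- ^ k x = x + d`.
  let g : KSpace A → KSpace A := fun q => act A (-(k : ℤ)) (q + d)
  have hmaps : Set.MapsTo g (tile hD) (tile hD) := fun q hq => (hd q hq).1
  have hcontr : ContractingWith (1 / 2) (hmaps.restrict g (tile hD) (tile hD)) := by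
    refine ⟨by rw [← NNReal.coe_lt_coe]; norm_num, LipschitzWith.of_dist_le_mul fun p q => ?_⟩
    change dist (g p) (g q) ≤ _ * dist (p : KSpace A) q
    rw [dist_eq_norm, dist_eq_norm, ← map_sub, add_sub_add_right_eq_sub]
    exact hk _
  obtain ⟨x, hx, hgx, -⟩ := hcontr.exists_fixedPoint' (isCompact_tile hD).isComplete hmaps
    (hUF hu) (edist_ne_top _ _)
  have hgx' : act A (-(k : ℤ)) (x + d) = x := hgx
  refine ⟨k, hk1, d, hdk, x, ?_, ?_⟩
  · nth_rewrite 1 [← hgx']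
    rw [act_act_neg]
  · obtain ⟨δ, hδ, hδU⟩ := Metric.isOpen_iff.1 hU x (hεU (hgx' ▸ (hd x hx).2))
    exact ⟨δ, hδ, hδU.trans hUF⟩

theorem IsTiling.image_add {F S : Set (KSpace A)} (h : IsTiling F S) (t : KSpace A) :
    IsTiling F ((fun s => s + t) '' S) where
  covers := by
    refine Set.eq_univ_of_forall fun p => ?_
    have hp : p - t ∈ ⋃ s ∈ S, translate F s := h.covers ▸ Set.mem_univ _
    simp only [Set.mem_iUnion, exists_prop] at hp
    obtain ⟨s, hs, hps⟩ := hp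
    refine Set.mem_biUnion (Set.mem_image_of_mem _ hs) ?_
    rw [mem_translate] at hps ⊢
    rwa [add_comm, ← sub_sub]
  null_inter := by
    rintro _ ⟨s, hs, rfl⟩ _ ⟨s', hs', rfl⟩ hne
    rw [translate_inter_translate_add, mu_translate]
    exact h.null_inter s hs s' hs' fun h => hne (by rw [h])

/-! ### The tiling obtained by expanding around the periodic point -/

/-- `S = ⋃_m (φ(D_{k m}) - e_m)` for a point `x`, where `e_m = A ^ (k m) x - x`. -/
def expansionSet (D : Finset (Fin n → ℚ)) (k : ℕ) (x : KSpace A) : Set (KSpace A) :=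
  {s | ∃ m : ℕ, s + (act A ((k * m : ℕ) : ℤ) x - x) ∈ blockSet A D (k * m)}

variable {k : ℕ} {d x : KSpace A}

/-- `e_m` consists of `m` copies of the digit block `d`. Adding one at the top, as here, compares
consecutive stages of `S`; adding one at the bottom, as in the primed version, describes the action
of `A ^ k`. -/
theorem act_mul_succ_sub (hx : act A (k : ℤ) x = x + d) (m : ℕ) :
    act A ((k * (m + 1) : ℕ) : ℤ) x - x =
      (act A ((k * m : ℕ) : ℤ) x - x) + act A ((k * m : ℕ) : ℤ) d := by
  rw [Nat.mul_succ, ← act_act, hx, map_add]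
  abel

theorem act_mul_succ_sub' (hx : act A (k : ℤ) x = x + d) (m : ℕ) :
    act A ((k * (m + 1) : ℕ) : ℤ) x - x = d + act A (k : ℤ) (act A ((k * m : ℕ) : ℤ) x - x) := by
  rw [Nat.mul_succ, add_comm, ← act_act, map_sub, hx]
  abel

theorem act_mul_sub_mem (hD : IsDigitSet A D) (hd : d ∈ blockSet A D k)
    (hx : act A (k : ℤ) x = x + d)
    (m : ℕ) :
    act A ((k * m : ℕ) : ℤ) x - x ∈ blockSet A D (k * m) := by
  induction m with
  | zero =>
    rw [Nat.mul_zero, Nat.cast_zero, act_zero, sub_self]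
    exact zero_mem_blockSet_zero D
  | succ m ih =>
    rw [act_mul_succ_sub' hx, Nat.mul_succ, add_comm (k * m), blockSet_add hD]
    exact ⟨d, hd, _, ⟨_, ih, rfl⟩, rfl⟩

/-- Putting the block `d` on top of both `s + e_m` and `e_m` leaves `s` unchanged. So the stages
`φ(D_{km}) - e_m` increase. -/
theorem expansion_succ (hD : IsDigitSet A D) (hd : d ∈ blockSet A D k)
    (hx : act A (k : ℤ) x = x + d)
    {s : KSpace A} {m : ℕ}
    (hs : s + (act A ((k * m : ℕ) : ℤ) x - x) ∈ blockSet A D (k * m)) :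
    s + (act A ((k * (m + 1) : ℕ) : ℤ) x - x) ∈ blockSet A D (k * (m + 1)) := by
  rw [act_mul_succ_sub hx, Nat.mul_succ, blockSet_add hD, ← add_assoc]
  exact ⟨_, hs, _, ⟨d, hd, rfl⟩, rfl⟩

theorem expansion_mono (hD : IsDigitSet A D) (hd : d ∈ blockSet A D k)
    (hx : act A (k : ℤ) x = x + d)
    {s : KSpace A} {m l : ℕ} (hml : m ≤ l)
    (hs : s + (act A ((k * m : ℕ) : ℤ) x - x) ∈ blockSet A D (k * m)) :
    s + (act A ((k * l : ℕ) : ℤ) x - x) ∈ blockSet A D (k * l) := by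
  induction l, hml using Nat.le_induction with
  | base => exact hs
  | succ l _ ih => exact expansion_succ hD hd hx ih

theorem expansionSet_subset_delta (hD : IsDigitSet A D) (hd : d ∈ blockSet A D k)
    (hx : act A (k : ℤ) x = x + d)
    (hk : 1 ≤ k) : expansionSet D k x ⊆ delta A D := by
  rintro s ⟨m, hs⟩
  -- Stage `m + 1` rather than `m`, since `Δ` only admits blocks of positive length and `m` may be
  -- `0`.
  refine (mem_delta hD).2 ⟨k * (m + 1), Nat.mul_pos hk m.succ_pos, _,
    expansion_succ hD hd hx hs, _, act_mul_sub_mem hD hd hx (m + 1), ?_⟩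
  rw [add_sub_cancel_right]

/-- Covering holds because expanding the ball around `x` reaches every point; overlaps are null
because any two elements of `S` belong to a common stage. -/
theorem isTiling_expansionSet (hD : IsDigitSet A D) (hd : d ∈ blockSet A D k)
    (hx : act A (k : ℤ) x = x + d)
    (hk : 1 ≤ k) {δ : ℝ} (hδ : 0 < δ)
    (hball : Metric.ball x δ ⊆ tile hD) : IsTiling (tile hD) (expansionSet D k x) where
  covers := by
    refine Set.eq_univ_of_forall fun q => ?_
    obtain ⟨N, hN⟩ := eventually_atTop.1 (eventually_norm_act_neg_le A
      (show 0 < δ / (‖q - x‖ + 1) by positivity))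
    have h1 := hN (k * N) (Nat.le_mul_of_pos_left N hk) (q - x)
    have h2 : ‖act A (-((k * N : ℕ) : ℤ)) (q - x)‖ < δ :=
      calc _ ≤ δ / (‖q - x‖ + 1) * ‖q - x‖ := h1
        _ < δ / (‖q - x‖ + 1) * (‖q - x‖ + 1) := by gcongr; linarith
        _ = δ := div_mul_cancel₀ _ (by positivity)
    have h3 : x + act A (-((k * N : ℕ) : ℤ)) (q - x) ∈ tile hD :=
      hball (by rwa [Metric.mem_ball, dist_eq_norm, add_sub_cancel_left])
    -- `q` is pulled back towards `x`, into the ball; expanding again returns `q + e_N`.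
    have h4 : q + (act A ((k * N : ℕ) : ℤ) x - x) ∈ act A ((k * N : ℕ) : ℤ) '' tile hD := by
      refine ⟨_, h3, ?_⟩
      rw [map_add, act_act_neg]
      abel
    rw [act_image_tile] at h4
    simp only [Set.mem_iUnion, exists_prop, mem_translate] at h4
    obtain ⟨p, hp, hpq⟩ := h4
    refine Set.mem_biUnion (x := p - (act A ((k * N : ℕ) : ℤ) x - x)) ⟨N, ?_⟩ ?_
    · rwa [sub_add_cancel]
    · rw [mem_translate]
      convert hpq using 1
      abel
  null_inter := by
    rintro s ⟨m, hs⟩ s' ⟨m', hs'⟩ hne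
    have h1 := expansion_mono hD hd hx (le_max_left m m') hs
    have h2 := expansion_mono hD hd hx (le_max_right m m') hs'
    have h3 := mu_inter_eq_zero hD h1 h2 fun h => hne (add_right_cancel h)
    rwa [translate_inter_translate_add, mu_translate] at h3

/-- `A ^ k (F + s - x)` consists of the tiles at `p + A ^ k (s - x) = (p + A ^ k s - d) - x`, `p ∈
φ(D_k)`. If `s` is in stage `m`, then `p + A ^ k s - d` is in stage `m + 1`: adding `e_{m+1} = d + A
^ k e_m` gives `p + A ^ k (s + e_m)`. -/
theorem isSelfReplicating_expansionSet (hD : IsDigitSet A D) (hd : d ∈ blockSet A D k)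
    (hx : act A (k : ℤ) x = x + d)
    (hk : 1 ≤ k) {δ : ℝ} (hδ : 0 < δ)
    (hball : Metric.ball x δ ⊆ tile hD) :
    IsSelfReplicating (act A (k : ℤ)) (tile hD) ((fun s => s + -x) '' expansionSet D k x) where
  isTiling := (isTiling_expansionSet hD hd hx hk hδ hball).image_add (-x)
  isExpandingLinear := isExpandingLinear_act hk
  exists_finite := by
    rintro _ ⟨s, ⟨m, hs⟩, rfl⟩
    refine ⟨(fun p => p + act A (k : ℤ) (s + -x)) '' blockSet A D k, ?_,
      (blockSet_finite D k).image _, ?_⟩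
    · rintro _ ⟨p, hp, rfl⟩
      refine ⟨p + act A (k : ℤ) s - d, ⟨m + 1, ?_⟩, ?_⟩
      · rw [act_mul_succ_sub' hx, Nat.mul_succ, add_comm (k * m), blockSet_add hD]
        refine ⟨p, hp, _, ⟨_, hs, rfl⟩, ?_⟩
        change p + _ = _
        rw [map_add]
        abel
      · change _ = p + _
        rw [map_add, map_neg, hx]
        abel_nf
    · rw [act_image_translate, act_image_tile, Set.biUnion_image]
      ext y
      simp only [mem_translate, Set.mem_iUnion, exists_prop, sub_sub, add_comm]

theorem zero_mem_expansionSet : (0 : KSpace A) ∈ expansionSet D k x := by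
  refine ⟨0, ?_⟩
  rw [Nat.mul_zero, Nat.cast_zero, act_zero, sub_self, add_zero]
  exact zero_mem_blockSet_zero D

theorem isAtomicSelfReplicating_expansionSet (hD : IsDigitSet A D) (hd : d ∈ blockSet A D k)
    (hx : act A (k : ℤ) x = x + d)
    (hF : ∃ U ⊆ tile hD, IsOpen U ∧ U.Nonempty)
    (hk : 1 ≤ k) {δ : ℝ} (hδ : 0 < δ) (hball : Metric.ball x δ ⊆ tile hD) :
    IsAtomicSelfReplicating (act A (k : ℤ)) (tile hD)
      ((fun s => s + -x) '' expansionSet D k x) where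
  toIsSelfReplicating := isSelfReplicating_expansionSet hD hd hx hk hδ hball
  atomic := by
    refine ⟨0 + -x, ⟨⟨0, zero_mem_expansionSet, rfl⟩, ?_⟩, ?_⟩
    · rw [mem_translate, zero_add, sub_neg_eq_add, zero_add]
      exact hball (Metric.mem_ball_self hδ)
    · rintro _ ⟨⟨s, hs, rfl⟩, h0⟩
      by_contra hne
      have hs0 : s ≠ 0 := fun h => hne (by rw [h])
      have hnull := (isTiling_expansionSet hD hd hx hk hδ hball).null_inter 0
        zero_mem_expansionSet s hs hs0.symm
      have hxs : x - s ∈ tile hD := by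
        rw [mem_translate, zero_sub] at h0
        change -(s + -x) ∈ tile hD at h0
        rwa [← sub_eq_add_neg, neg_sub] at h0
      -- The part of `F` near `x - s`, moved by `s`, lies in the ball around `x`, hence in the null
      -- set `F ∩ (F + s)`.
      refine mu_tile_inter_ball_pos hD hF hxs hδ ?_
      rw [← mu_translate _ s]
      refine measure_mono_null ?_ hnull
      rintro _ ⟨y, ⟨hy, hyb⟩, rfl⟩
      refine ⟨?_, ⟨y, hy, rfl⟩⟩
      rw [mem_translate, sub_zero]
      refine hball ?_
      rw [Metric.mem_ball, dist_eq_norm] at hyb ⊢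
      rwa [sub_sub_eq_add_sub] at hyb

/-- If `s - s' = p - q` with `p` and `q` in the same `φ(D_k)`, the pair of tiles is a common
translate of the pair at `p` and `q`. -/
theorem mu_inter_eq_zero_of_sub_mem_delta (hD : IsDigitSet A D) {s s' : KSpace A}
    (h : s - s' ∈ delta A D)
    (hne : s ≠ s') : mu A (translate (tile hD) s ∩ translate (tile hD) s') = 0 := by
  obtain ⟨k, -, p, hp, q, hq, hpq⟩ := (mem_delta hD).1 h
  have hs : s = p + (s' - q) := by
    rw [← sub_add_cancel s s', hpq]
    abel
  have hs' : s' = q + (s' - q) := (add_sub_cancel q s').symm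
  have h0 := mu_inter_eq_zero hD hp hq fun h => hne ?_
  · rwa [← mu_translate _ (s' - q), ← translate_inter_translate_add, ← hs, ← hs'] at h0
  rwa [h, sub_self, sub_eq_zero] at hpq

end Main

end RationalTile

end

theorem mainTheorem4 {n : ℕ} (A : Matrix (Fin n) (Fin n) ℚ)
    [Fact (RationalTile.IsExpanding A)] [Fact (2 ≤ RationalTile.bIndex A)]
    (D : Finset (Fin n → ℚ)) (hD : RationalTile.IsDigitSet A D)
    (hF : ∃ U ⊆ RationalTile.tile hD, IsOpen U ∧ U.Nonempty) :
    (∃ S ⊆ RationalTile.delta A D, RationalTile.IsTiling (RationalTile.tile hD) S ∧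
      ∃ t : RationalTile.KSpace A, ∃ k : ℕ, 1 ≤ k ∧
        RationalTile.IsAtomicSelfReplicating (RationalTile.act A (k : ℤ))
          (RationalTile.tile hD) ((fun s => s + t) '' S)) ∧
    ((∃ H : AddSubgroup (RationalTile.KSpace A),
        (H : Set (RationalTile.KSpace A)) = RationalTile.delta A D) →
      RationalTile.IsTiling (RationalTile.tile hD) (RationalTile.delta A D)) := by
  obtain ⟨k, hk, d, hd, x, hx, δ, hδ, hball⟩ := RationalTile.exists_periodic_interior hD hF
  have hS := RationalTile.expansionSet_subset_delta hD hd hx hk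
  have htil := RationalTile.isTiling_expansionSet hD hd hx hk hδ hball
  refine ⟨⟨_, hS, htil, -x, k, hk,
    RationalTile.isAtomicSelfReplicating_expansionSet hD hd hx hF hk hδ hball⟩, ?_⟩
  rintro ⟨H, hH⟩
  refine ⟨Set.eq_univ_of_univ_subset ?_, fun s hs s' hs' hne => ?_⟩
  · rw [← htil.covers]
    exact Set.biUnion_subset_biUnion_left hS
  · rw [← hH] at hs hs'
    exact RationalTile.mu_inter_eq_zero_of_sub_mem_delta hD (hH ▸ H.sub_mem hs hs') hne
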